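/- **Setting.** Let $c,a\in C^\infty(\mathbb R^d)$ be real valued, $c$ bounded between two positive constants, $a\ge 0$. Let $\Omega\subset\mathbb R^d$ be open with smooth boundary, $\Omega_0$ open with compact closure $\overline{\Omega_0}\subset\Omega$, $S\subset\partial\Omega$ closed with nonempty relative interior, $T>0$, and let $\chi\in C^\infty(\partial\Omega\times[0,T])$ be nonnegative with $\operatorname{supp}\chi=\Gamma:=S\times[0,T]$. Consider the Hilbert spaces - $X_0=L^2(\Omega_0)$ with norm $\|c^{-1}f\|_{L^2(\Omega_0)}$, and $X_1=H^1_0(\Omega_0)$ (the closure of $C_c^\infty(\Omega_0)$ in $H^1(\mathbb R^d)$) with norm $\|\nabla f\|_{L^2}$; - $Y_0$, the functions $g$ on $\Gamma$ with norm $\|g\|_{Y_0}=\|\sqrt\chi\,g\|_{L^2(\Gamma)}<\infty$, and $Y_1$, the functions $g$ on $\Gamma$ with $g(\cdot,0)=0$ and norm $\|g\|_{Y_1}=\|g_t\|_{Y_0}<\infty$ (completed, i.e. represented by $g_t\in Y_0$). For $\varphi\in C_c^\infty(\Omega_0)$ let $\mathbf W\varphi=p|_\Gamma$, where $p$ is the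 classical solution of $$c^{-2}p_{tt}+a\,p_t-\Delta p=0\ (t>0),\qquad p(\cdot,0)=\varphi,\qquad p_t(\cdot,0)=-c^2a\,\varphi .$$ For $i\in\{0,1\}$ let $\mathbf W_i\colon X_i\to Y_i$ be the bounded linear operator that extends $\mathbf W$ from $C_c^\infty(\Omega_0)$ to $X_i$ (with $\mathbf W_i:=0$ if there is no bounded extension), and assume that $\mathbf W_i$ is injective. No visibility condition is assumed. **Methods.** For $g\in Y_i$ let $(f_k)_{k\ge0}\subset X_i$, $f_0=0$, be the iterates for $\mathbf W_if=g$ of one of the following methods (with the convention $0/0=0$, so that an iteration that has reached a solution of the normal equation stays there): - Landweber: $f_{k+1}=f_k-\gamma s_k$, $s_k=\mathbf W_i^*(\mathbf W_if_k-g)$, with a fixed $\gamma>0$ such that $\gamma\,\|\mathbf W_i^*\mathbf W_i\|<2$; - steepest descent: $f_{k+1}=f_k-\gamma_ks_k$ with the same $s_k$ and $\gamma_k=\|s_k\|^2/\|\mathbf W_is_k\|^2$; - conjugate gradients (CGNE): $r_0=g$, $d_0=\mathbf W_i^*r_0$, and $\alpha_k=\|\mathbf W_i^*r_k\|^2/\|\mathbf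 W_id_k\|^2$, $f_{k+1}=f_k+\alpha_kd_k$, $r_{k+1}=r_k-\alpha_k\mathbf W_id_k$, $\beta_k=\|\mathbf W_i^*r_{k+1}\|^2/\|\mathbf W_i^*r_k\|^2$, $d_{k+1}=\mathbf W_i^*r_{k+1}+\beta_kd_k$. For $\tau>1$ and $\delta>0$ the stopping index of Morozov's discrepancy principle is $$k_*(\delta,g)=\min\{k\in\mathbb N_0:\ \|\mathbf W_if_k-g\|_{Y_i}\le\tau\delta\}.$$ **Theorem.** Let $f\in X_i$ and fix one of the three methods. 1. (Exact data.) For $g=\mathbf W_if$ the iterates satisfy $\|f_k-f\|_{X_i}\to0$ as $k\to\infty$. 2. (Noisy data.) Let $\tau>1$, let $\delta(m)>0$ converge to $0$, and let $g_m\in Y_i$ satisfy $\|g_m-\mathbf W_if\|_{Y_i}\le\delta(m)$ for all $m\in\mathbb N$. Let $f_k^{m}$ be the iterates for the data $g_m$. Then the stopping indices $k_*(\delta(m),g_m)$ are well defined (the minimum is attained), and $\|f^{m}_{k_*(\delta(m),g_m)}-f\|_{X_i}\to0$ as $m\to\infty$. -/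

import Mathlib

open MeasureTheory Filter Topology
open scoped ContDiff ENNReal InnerProductSpace

noncomputable section

namespace PAT

/-- The physical space `ℝ^d` with its Euclidean norm. -/
abbrev Space (d : ℕ) : Type := EuclideanSpace ℝ (Fin d)

/-- The open set `Ω` has a smooth boundary: near each boundary point it is the sublevel set
`{ρ < 0}` of a smooth function `ρ` that is regular at that point. -/
def HasSmoothBoundary {d : ℕ} (Ω : Set (Space d)) : Prop :=
  ∀ y ∈ frontier Ω, ∃ U : Set (Space d), IsOpen U ∧ y ∈ U ∧ ∃ ρ : Space d → ℝ,
    ContDiff ℝ ∞ ρ ∧ ρ y = 0 ∧ fderiv ℝ ρ y ≠ 0 ∧ ∀ x ∈ U, x ∈ Ω ↔ ρ x < 0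

/-- The coefficients and the geometry of photoacoustic tomography in a medium with variable sound
speed `c` and variable damping `a`: the initial pressure is supported in `Ω₀ ⋐ Ω`, and the pressure
is measured on `S × [0, T]`, where `S ⊆ ∂Ω`; `χ` is the weight of the data space. Smooth functions
on `∂Ω × [0, T]` are given as restrictions of smooth functions on `ℝ^d × ℝ`. -/
structure Setting (d : ℕ) where
  /-- sound speed -/
  c : Space d → ℝ
  /-- damping coefficient -/
  a : Space d → ℝ
  /-- domain enclosed by the detection surface -/
  Ω : Set (Space d)
  /-- region that contains the support of the initial pressure -/
  Ω₀ : Set (Space d)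
  /-- observation surface -/
  S : Set (Space d)
  /-- final measurement time -/
  T : ℝ
  /-- weight function on the detection surface -/
  χ : Space d × ℝ → ℝ
  c_smooth : ContDiff ℝ ∞ c
  c_bounds : ∃ m M : ℝ, 0 < m ∧ ∀ x, m ≤ c x ∧ c x ≤ M
  a_smooth : ContDiff ℝ ∞ a
  a_nonneg : ∀ x, 0 ≤ a x
  Ω_open : IsOpen Ω
  Ω_boundary : HasSmoothBoundary Ω
  Ω₀_open : IsOpen Ω₀
  Ω₀_compact : IsCompact (closure Ω₀)
  Ω₀_subset : closure Ω₀ ⊆ Ω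
  S_closed : IsClosed S
  S_subset : S ⊆ frontier Ω
  S_interior : ∃ y ∈ S, ∃ U : Set (Space d), IsOpen U ∧ y ∈ U ∧ U ∩ frontier Ω ⊆ S
  T_pos : 0 < T
  χ_smooth : ContDiff ℝ ∞ χ
  χ_nonneg : ∀ y ∈ frontier Ω, ∀ t ∈ Set.Icc 0 T, 0 ≤ χ (y, t)
  χ_support : closure {z ∈ frontier Ω ×ˢ Set.Icc 0 T | χ z ≠ 0} = S ×ˢ Set.Icc 0 T

/-- `φ ∈ C_c^∞(U)`. -/
def IsTestFunction {d : ℕ} (U : Set (Space d)) (φ : Space d → ℝ) : Prop :=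
  ContDiff ℝ ∞ φ ∧ HasCompactSupport φ ∧ tsupport φ ⊆ U

/-! ### The Sobolev space `H₀¹(U)` -/

/-- Pairs `(f, G)` with `f ∈ L²(ℝ^d)` and `G ∈ L²(ℝ^d; ℝ^d)`, with the norm
`(‖f‖² + ‖G‖²)^{1/2}`; the space `H¹(ℝ^d)` sits in it through `f ↦ (f, ∇f)`. -/
abbrev L2Pairs (d : ℕ) : Type :=
  WithLp 2 (Lp ℝ 2 (volume : Measure (Space d)) × Lp (Space d) 2 (volume : Measure (Space d)))

theorem IsTestFunction.add {d : ℕ} {U : Set (Space d)} {φ ψ : Space d → ℝ}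
    (hφ : IsTestFunction U φ) (hψ : IsTestFunction U ψ) : IsTestFunction U (φ + ψ) :=
  ⟨hφ.1.add hψ.1, hφ.2.1.add hψ.2.1,
    (tsupport_add φ ψ).trans (Set.union_subset hφ.2.2 hψ.2.2)⟩

theorem IsTestFunction.const_smul {d : ℕ} {U : Set (Space d)} {φ : Space d → ℝ}
    (hφ : IsTestFunction U φ) (r : ℝ) : IsTestFunction U (r • φ) :=
  ⟨hφ.1.const_smul r, hφ.2.1.mono (Function.support_const_smul_subset r φ),
    (closure_mono (Function.support_const_smul_subset r φ)).trans hφ.2.2⟩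

/-- The pairs `(φ, ∇φ)` with `φ ∈ C_c^∞(U)`. -/
def testPairs {d : ℕ} (U : Set (Space d)) : Submodule ℝ (L2Pairs d) where
  carrier := {u | ∃ φ : Space d → ℝ, IsTestFunction U φ ∧
    u.fst =ᵐ[volume] φ ∧ u.snd =ᵐ[volume] gradient φ}
  zero_mem' := by
    refine ⟨0, ⟨contDiff_const, HasCompactSupport.zero, by simp⟩, ?_, ?_⟩
    · exact Lp.coeFn_zero ..
    · refine (Lp.coeFn_zero ..).trans (Eventually.of_forall fun x => ?_)
      simp [gradient]
  add_mem' := by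
    rintro u v ⟨φ, hφ, h1, h2⟩ ⟨ψ, hψ, h3, h4⟩
    refine ⟨φ + ψ, hφ.add hψ, (Lp.coeFn_add _ _).trans (h1.add h3), ?_⟩
    refine (Lp.coeFn_add _ _).trans ((h2.add h4).trans (Eventually.of_forall fun x => ?_))
    have e1 : DifferentiableAt ℝ φ x := hφ.1.differentiable (by simp) x
    have e2 : DifferentiableAt ℝ ψ x := hψ.1.differentiable (by simp) x
    simp [gradient, fderiv_add e1 e2]
  smul_mem' := by
    rintro r u ⟨φ, hφ, h1, h2⟩
    refine ⟨r • φ, hφ.const_smul r, (Lp.coeFn_smul r _).trans (h1.const_smul r), ?_⟩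
    refine (Lp.coeFn_smul r _).trans ((h2.const_smul r).trans (Eventually.of_forall fun x => ?_))
    have e1 : DifferentiableAt ℝ φ x := hφ.1.differentiable (by simp) x
    simp [gradient, fderiv_const_smul e1]

/-- `H₀¹(U)`: the closure of `C_c^∞(U)` in `H¹(ℝ^d)`; the element `f` is stored as `(f, ∇f)`. -/
def H01 {d : ℕ} (U : Set (Space d)) : Submodule ℝ (L2Pairs d) :=
  (testPairs U).topologicalClosure

theorem poincare_test {d : ℕ} {U : Set (Space d)} {R : ℝ} {v : Space d} (hv : ‖v‖ = 1)
    (hR : ∀ x ∈ U, ‖x‖ ≤ R) {u : L2Pairs d} (hu : u ∈ testPairs U) :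
    ‖u.fst‖ ^ 2 ≤ 4 * R ^ 2 * ‖u.snd‖ ^ 2 := by
  obtain ⟨φ, ⟨hs, hc, hU⟩, h1, h2⟩ := hu
  have hd : Differentiable ℝ φ := hs.differentiable (by simp)
  have hcd : Continuous (fderiv ℝ φ) := hs.continuous_fderiv (by simp)
  have e1 : ‖u.fst‖ ^ 2 = ∫ x, φ x ^ 2 := by
    rw [← real_inner_self_eq_norm_sq, L2.inner_def]
    refine integral_congr_ae (h1.mono fun x hx => ?_)
    simp [hx, sq]
  have i2 : Integrable (fun x => ‖gradient φ x‖ ^ 2) := by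
    refine (L2.integrable_inner (𝕜 := ℝ) u.snd u.snd).congr (h2.mono fun x hx => ?_)
    simp [hx]
  have e2 : ‖u.snd‖ ^ 2 = ∫ x, ‖gradient φ x‖ ^ 2 := by
    rw [← real_inner_self_eq_norm_sq, L2.inner_def]
    refine integral_congr_ae (h2.mono fun x hx => ?_)
    simp [hx]
  have i1 : Integrable (fun x => φ x ^ 2) :=
    (hs.continuous.pow 2).integrable_of_hasCompactSupport (by
      refine hc.mono fun x hx => ?_
      simp only [Function.mem_support] at hx ⊢
      exact fun h => hx (by simp [h]))
  have hg : ∀ x, HasFDerivAt (fun y : Space d => ⟪v, y⟫_ℝ) (innerSL ℝ v) x :=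
    fun x => (innerSL ℝ v).hasFDerivAt
  have hf : ∀ x, fderiv ℝ (fun y => φ y ^ 2) x v = 2 * φ x * fderiv ℝ φ x v := by
    intro x
    have := ((hd x).hasFDerivAt.pow 2).fderiv
    rw [this]; simp
  have hgrad : ∀ x, |fderiv ℝ φ x v| ≤ ‖gradient φ x‖ := by
    intro x
    have : ‖gradient φ x‖ = ‖fderiv ℝ φ x‖ := by simp [gradient]
    rw [this, ← Real.norm_eq_abs]
    simpa [hv] using (fderiv ℝ φ x).le_opNorm v
  have i3 : Integrable (fun x => 2 * φ x * fderiv ℝ φ x v * ⟪v, x⟫_ℝ) := by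
    refine Continuous.integrable_of_hasCompactSupport ?_ ?_
    · have := hs.continuous
      fun_prop
    · refine hc.mono fun x hx => ?_
      simp only [Function.mem_support] at hx ⊢
      exact fun h => hx (by simp [h])
  have ibp : ∫ x, φ x ^ 2 = - ∫ x, 2 * φ x * fderiv ℝ φ x v * ⟪v, x⟫_ℝ := by
    have := integral_mul_fderiv_eq_neg_fderiv_mul_of_integrable (μ := (volume : Measure (Space d)))
      (f := fun y => φ y ^ 2) (g := fun y : Space d => ⟪v, y⟫_ℝ) (v := v)
      (by simpa only [hf] using i3)
      (by simpa only [(hg _).fderiv, innerSL_apply_apply, real_inner_self_eq_norm_sq, hv, one_pow,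
        mul_one] using i1)
      (by
        refine Continuous.integrable_of_hasCompactSupport ?_ ?_
        · have := hs.continuous
          fun_prop
        · refine hc.mono fun x hx => ?_
          simp only [Function.mem_support] at hx ⊢
          exact fun h => hx (by simp [h]))
      (fun x _ => ((hd x).pow 2)) (fun x _ => (hg x).differentiableAt)
    simpa only [hf, (hg _).fderiv, innerSL_apply_apply, real_inner_self_eq_norm_sq, hv, one_pow,
      mul_one] using this
  have key : ∫ x, φ x ^ 2 ≤ ∫ x, (1 / 2 * φ x ^ 2 + 2 * R ^ 2 * ‖gradient φ x‖ ^ 2) := by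
    conv_lhs => rw [ibp, ← integral_neg]
    refine integral_mono i3.neg ((i1.const_mul _).add (i2.const_mul _)) fun x => ?_
    by_cases hx : φ x = 0
    · simp only [hx]
      have : 0 ≤ 2 * R ^ 2 * ‖gradient φ x‖ ^ 2 := by positivity
      simpa using this
    · have hxU : x ∈ U := hU (subset_tsupport φ hx)
      have hxv : |⟪v, x⟫_ℝ| ≤ R := by
        have := abs_real_inner_le_norm v x
        rw [hv, one_mul] at this
        exact this.trans (hR x hxU)
      have hR0 : 0 ≤ R := (abs_nonneg _).trans hxv
      have hprod : |fderiv ℝ φ x v * ⟪v, x⟫_ℝ| ≤ ‖gradient φ x‖ * R := by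
        rw [abs_mul]
        exact mul_le_mul (hgrad x) hxv (abs_nonneg _) (norm_nonneg _)
      have hsq : (fderiv ℝ φ x v * ⟪v, x⟫_ℝ) ^ 2 ≤ (‖gradient φ x‖ * R) ^ 2 :=
        sq_le_sq' (neg_le_of_abs_le hprod) (le_of_abs_le hprod)
      nlinarith [sq_nonneg (φ x + 2 * (fderiv ℝ φ x v * ⟪v, x⟫_ℝ))]
  rw [integral_add (i1.const_mul _) (i2.const_mul _), integral_const_mul, integral_const_mul,
    ← e1, ← e2] at key
  linarith

/-- Poincaré inequality on `H₀¹(U)`. -/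
theorem poincare {d : ℕ} {U : Set (Space d)} {R : ℝ} {v : Space d} (hv : ‖v‖ = 1)
    (hR : ∀ x ∈ U, ‖x‖ ≤ R) {u : L2Pairs d} (hu : u ∈ H01 U) :
    ‖u.fst‖ ^ 2 ≤ 4 * R ^ 2 * ‖u.snd‖ ^ 2 := by
  have hcl : IsClosed {u : L2Pairs d | ‖u.fst‖ ^ 2 ≤ 4 * R ^ 2 * ‖u.snd‖ ^ 2} := by
    have c1 : Continuous fun u : L2Pairs d => u.fst := (WithLp.fstL 2 ℝ _ _).continuous
    have c2 : Continuous fun u : L2Pairs d => u.snd := (WithLp.sndL 2 ℝ _ _).continuous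
    exact isClosed_le (c1.norm.pow 2) (continuous_const.mul (c2.norm.pow 2))
  exact closure_minimal (fun w hw => poincare_test hv hR hw) hcl hu

namespace Setting

variable {d : ℕ} (P : Setting d)

/-! ### The image spaces `X₀`, `X₁` -/

/-- `X₀ = L²(Ω₀)` with the norm `‖c⁻¹ f‖_{L²(Ω₀)}`. -/
abbrev ImageL2 : Type :=
  Lp ℝ 2 ((volume.restrict P.Ω₀).withDensity fun x => ENNReal.ofReal ((P.c x)⁻¹ ^ 2))

/-- `X₁ = H₀¹(Ω₀)`, the functions in `H¹(ℝ^d)` supported in the closure of `Ω₀`. Its norm, defined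
below, is `‖∇f‖_{L²}`. -/
def ImageH1 : Type := H01 P.Ω₀

instance : AddCommGroup P.ImageH1 := inferInstanceAs (AddCommGroup (H01 P.Ω₀))

instance : Module ℝ P.ImageH1 := inferInstanceAs (Module ℝ (H01 P.Ω₀))

/-- The function in `L²(ℝ^d)` that underlies an element of `H₀¹(Ω₀)`. -/
def ImageH1.toLp {P : Setting d} (f : P.ImageH1) : Lp ℝ 2 (volume : Measure (Space d)) :=
  (show H01 P.Ω₀ from f).1.fst

/-- The gradient as a linear map `H₀¹(Ω₀) → L²(ℝ^d; ℝ^d)`. -/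
def grad : P.ImageH1 →ₗ[ℝ] Lp (Space d) 2 (volume : Measure (Space d)) :=
  (WithLp.sndL 2 ℝ (Lp ℝ 2 (volume : Measure (Space d)))
    (Lp (Space d) 2 (volume : Measure (Space d)))).toLinearMap ∘ₗ (H01 P.Ω₀).subtype

theorem exists_poincare : ∃ C : ℝ, 0 ≤ C ∧ ∀ u ∈ H01 P.Ω₀, ‖u.fst‖ ≤ C * ‖u.snd‖ := by
  obtain ⟨y, hy, -⟩ := P.S_interior
  obtain ⟨v, hv⟩ : ∃ v : Space d, ‖v‖ = 1 := by
    rcases subsingleton_or_nontrivial (Space d) with h | h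
    · have hyf := P.S_subset hy
      rcases Set.eq_empty_or_nonempty P.Ω with h0 | ⟨z, hz⟩
      · simp [h0] at hyf
      · have : P.Ω = Set.univ := Set.eq_univ_of_forall fun x => Subsingleton.elim z x ▸ hz
        simp [this] at hyf
    · exact exists_norm_eq (Space d) zero_le_one
  obtain ⟨R, hR⟩ := P.Ω₀_compact.isBounded.exists_norm_le
  refine ⟨2 * |R|, by positivity, fun u hu => ?_⟩
  have h := poincare hv (fun x hx => hR x (subset_closure hx)) hu
  refine abs_le_of_sq_le_sq' (a := ‖u.fst‖) ?_ (by positivity) |>.2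
  rw [mul_pow, mul_pow, sq_abs]
  linarith

theorem norm_le_grad : ∃ C : ℝ, 0 ≤ C ∧ ∀ f : P.ImageH1,
    ‖((show H01 P.Ω₀ from f) : L2Pairs d)‖ ≤ C * ‖P.grad f‖ := by
  obtain ⟨C, hC, h⟩ := P.exists_poincare
  refine ⟨C + 1, by positivity, fun f => ?_⟩
  set u : H01 P.Ω₀ := f with hu
  have h1 := h u.1 u.2
  have h2 : ‖P.grad f‖ = ‖u.1.snd‖ := rfl
  have h3 : ‖u.1‖ ^ 2 = ‖u.1.fst‖ ^ 2 + ‖u.1.snd‖ ^ 2 := WithLp.prod_norm_sq_eq_of_L2 _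
  rw [h2]
  refine abs_le_of_sq_le_sq' (a := ‖u.1‖) ?_ (by positivity) |>.2
  rw [h3]
  nlinarith [norm_nonneg u.1.fst, norm_nonneg u.1.snd, mul_nonneg hC (norm_nonneg u.1.snd)]

theorem grad_injective : Function.Injective P.grad := by
  obtain ⟨C, -, h⟩ := P.norm_le_grad
  refine (injective_iff_map_eq_zero P.grad).2 fun f hf => ?_
  have h1 := h f
  rw [hf, norm_zero, mul_zero] at h1
  exact Subtype.ext (norm_le_zero_iff.1 h1)

instance : NormedAddCommGroup P.ImageH1 :=
  NormedAddCommGroup.induced P.ImageH1 _ P.grad P.grad_injective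

/-- The inner product of `X₁` is `⟨∇f, ∇g⟩_{L²}`. -/
instance : InnerProductSpace ℝ P.ImageH1 where
  inner f g := ⟪P.grad f, P.grad g⟫_ℝ
  norm_smul_le r f := by
    change ‖P.grad (r • f)‖ ≤ ‖r‖ * ‖P.grad f‖
    rw [map_smul, norm_smul]
  norm_sq_eq_re_inner f := norm_sq_eq_re_inner (𝕜 := ℝ) (P.grad f)
  conj_inner_symm f g := inner_conj_symm (P.grad f) (P.grad g)
  add_left f g h := by
    change ⟪P.grad (f + g), P.grad h⟫_ℝ = _
    rw [map_add, inner_add_left]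
  smul_left f g r := by
    change ⟪P.grad (r • f), P.grad g⟫_ℝ = _
    rw [map_smul, inner_smul_left]

theorem ImageH1.norm_eq (f : P.ImageH1) : ‖f‖ = ‖P.grad f‖ := rfl

instance : CompleteSpace P.ImageH1 := by
  obtain ⟨C, hC, h⟩ := P.norm_le_grad
  have : CompleteSpace (H01 P.Ω₀) :=
    (Submodule.isClosed_topologicalClosure (testPairs P.Ω₀)).completeSpace_coe
  let e : H01 P.Ω₀ →ₗ[ℝ] P.ImageH1 := LinearMap.id (R := ℝ) (M := H01 P.Ω₀)
  have he : ∀ u : H01 P.Ω₀, ‖e u‖ ≤ 1 * ‖u‖ := fun u => by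
    rw [one_mul]
    have h3 : ‖u.1‖ ^ 2 = ‖u.1.fst‖ ^ 2 + ‖u.1.snd‖ ^ 2 := WithLp.prod_norm_sq_eq_of_L2 _
    change ‖u.1.snd‖ ≤ ‖u.1‖
    refine abs_le_of_sq_le_sq' (a := ‖u.1.snd‖) ?_ (norm_nonneg _) |>.2
    rw [h3]
    linarith [sq_nonneg ‖u.1.fst‖]
  have hl : LipschitzWith 1 e := by
    have := (e.mkContinuous 1 he).lipschitz.weaken
      (K' := 1) (LinearMap.mkContinuous_norm_le e zero_le_one he)
    exact this
  have ha : AntilipschitzWith ⟨C, hC⟩ e :=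
    AddMonoidHomClass.antilipschitz_of_bound e fun u => h u
  have hc := ha.isComplete_range hl.uniformContinuous
  have hr : Set.range e = Set.univ := Set.range_eq_univ.2 fun f => ⟨f, rfl⟩
  exact completeSpace_iff_isComplete_univ.2 (hr ▸ hc)

/-! ### The data spaces `Y₀`, `Y₁` -/

/-- The measure `χ dσ dt` on `Γ = S × [0, T]`, where `σ` is the surface measure of `∂Ω`. -/
def dataMeasure : Measure (Space d × ℝ) :=
  ((μHE[d - 1].restrict P.S).prod (volume.restrict (Set.Icc 0 P.T))).withDensity
    fun z => ENNReal.ofReal (P.χ z)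

/-- `Y₀ = L²(Γ, χ dσ dt)`, with the norm `‖√χ g‖_{L²(Γ)}`. -/
abbrev DataL2 : Type := Lp ℝ 2 P.dataMeasure

/-- `Y₁`, the functions `g` on `Γ` with `g(·, 0) = 0` and `‖g‖ = ‖g_t‖_{Y₀} < ∞`. Such a `g` is
stored through its time derivative `g_t ∈ Y₀`, so that the norm is that of `Y₀`; the function itself
is `g(y, t) = ∫₀ᵗ g_t(y, s) ds`, see `DataH1.eval`. -/
abbrev DataH1 : Type := Lp ℝ 2 P.dataMeasure

/-- The function `g(y, t) = ∫₀ᵗ g_t(y, s) ds` that underlies an element of `Y₁`. -/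
def DataH1.eval {P : Setting d} (g : P.DataH1) (z : Space d × ℝ) : ℝ :=
  ∫ s in (0 : ℝ)..z.2, g (z.1, s)

/-! ### The two realizations of the spaces, `i = 0` (`L²`) and `i = 1` (`H¹`) -/

/-- The image space `X_i`. -/
def X : Fin 2 → Type
  | 0 => P.ImageL2
  | 1 => P.ImageH1

/-- The data space `Y_i`. -/
def Y : Fin 2 → Type
  | 0 => P.DataL2
  | 1 => P.DataH1

instance : (i : Fin 2) → NormedAddCommGroup (P.X i)
  | 0 => inferInstanceAs (NormedAddCommGroup P.ImageL2)
  | 1 => inferInstanceAs (NormedAddCommGroup P.ImageH1)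

instance : (i : Fin 2) → InnerProductSpace ℝ (P.X i)
  | 0 => inferInstanceAs (InnerProductSpace ℝ P.ImageL2)
  | 1 => inferInstanceAs (InnerProductSpace ℝ P.ImageH1)

instance : (i : Fin 2) → CompleteSpace (P.X i)
  | 0 => inferInstanceAs (CompleteSpace P.ImageL2)
  | 1 => inferInstanceAs (CompleteSpace P.ImageH1)

instance : (i : Fin 2) → NormedAddCommGroup (P.Y i)
  | 0 => inferInstanceAs (NormedAddCommGroup P.DataL2)
  | 1 => inferInstanceAs (NormedAddCommGroup P.DataH1)

instance : (i : Fin 2) → InnerProductSpace ℝ (P.Y i)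
  | 0 => inferInstanceAs (InnerProductSpace ℝ P.DataL2)
  | 1 => inferInstanceAs (InnerProductSpace ℝ P.DataH1)

instance : (i : Fin 2) → CompleteSpace (P.Y i)
  | 0 => inferInstanceAs (CompleteSpace P.DataL2)
  | 1 => inferInstanceAs (CompleteSpace P.DataH1)

/-! ### The forward operator -/

/-- `p` is a classical solution of the damped wave equation
`c⁻² p_tt + a p_t - Δp = 0` for `t > 0`, with `p(·, 0) = φ` and `p_t(·, 0) = -c² a φ`. -/
structure IsSolution (φ : Space d → ℝ) (p : Space d × ℝ → ℝ) : Prop where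
  contDiff : ContDiff ℝ 2 p
  wave : ∀ x : Space d, ∀ t : ℝ, 0 < t →
    (P.c x)⁻¹ ^ 2 * iteratedDeriv 2 (fun s => p (x, s)) t
      + P.a x * deriv (fun s => p (x, s)) t - Laplacian.laplacian (fun y => p (y, t)) x = 0
  init : ∀ x, p (x, 0) = φ x
  init_deriv : ∀ x, deriv (fun s => p (x, s)) 0 = -(P.c x ^ 2 * P.a x * φ x)

/-- The element `f` of `X_i` is the function `φ`. -/
def Represents : (i : Fin 2) → P.X i → (Space d → ℝ) → Prop
  | 0, f, φ => (show P.ImageL2 from f) =ᵐ[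
      (volume.restrict P.Ω₀).withDensity fun x => ENNReal.ofReal ((P.c x)⁻¹ ^ 2)] φ
  | 1, f, φ => ImageH1.toLp (show P.ImageH1 from f) =ᵐ[volume] φ

/-- The element `g` of `Y_i` is the restriction of `p` to `Γ` (for `i = 1` this is expressed by the
time derivatives; `p(·, 0)` has to vanish on `∂Ω`). -/
def IsTrace : (i : Fin 2) → P.Y i → (Space d × ℝ → ℝ) → Prop
  | 0, g, p => (show P.DataL2 from g) =ᵐ[P.dataMeasure] p
  | 1, g, p => (∀ y ∈ P.S, p (y, 0) = 0) ∧
      (show P.DataH1 from g) =ᵐ[P.dataMeasure] fun z => deriv (fun s => p (z.1, s)) z.2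

/-- `W` is a bounded operator `X_i → Y_i` with `W φ = p|_Γ` for all `φ ∈ C_c^∞(Ω₀)`, where `p` is
the solution of the wave equation with initial pressure `φ`. As `C_c^∞(Ω₀)` is dense in `X_i`,
there is at most one such operator. -/
def IsForward (i : Fin 2) (W : P.X i →L[ℝ] P.Y i) : Prop :=
  ∀ (φ : Space d → ℝ) (p : Space d × ℝ → ℝ) (f : P.X i), IsTestFunction P.Ω₀ φ →
    P.IsSolution φ p → P.Represents i f φ → P.IsTrace i (W f) p

open Classical in
/-- The forward operator `W_i : X_i → Y_i`, the continuous extension of `φ ↦ p|_Γ` from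
`C_c^∞(Ω₀)` to `X_i`; it is set to `0` if there is no continuous extension. -/
def forward (i : Fin 2) : P.X i →L[ℝ] P.Y i :=
  if h : ∃ W, P.IsForward i W then h.choose else 0

end Setting

/-! ### Iterative methods for `W f = g` in Hilbert spaces -/

section Iteration

variable {X Y : Type*} [NormedAddCommGroup X] [InnerProductSpace ℝ X] [CompleteSpace X]
  [NormedAddCommGroup Y] [InnerProductSpace ℝ Y] [CompleteSpace Y]

open ContinuousLinearMap (adjoint)

/-- Landweber's method with constant step size `γ`. -/
def landweber (W : X →L[ℝ] Y) (γ : ℝ) (g : Y) : ℕ → X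
  | 0 => 0
  | k + 1 => landweber W γ g k - γ • adjoint W (W (landweber W γ g k) - g)

/-- The steepest descent method. If `s_k = 0`, so that `f_k` solves the normal equation, then
`f_{k+1} = f_k`. -/
def steepestDescent (W : X →L[ℝ] Y) (g : Y) : ℕ → X
  | 0 => 0
  | k + 1 =>
    let f := steepestDescent W g k
    let s := adjoint W (W f - g)
    f - (‖s‖ ^ 2 / ‖W s‖ ^ 2) • s

/-- The variables of the conjugate gradient method: iterate, residual and search direction. -/
structure CGState (X Y : Type*) where
  /-- the iterate `f_k` -/
  f : X
  /-- the residual `r_k` -/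
  r : Y
  /-- the search direction `d_k` -/
  d : X

/-- One step of the conjugate gradient method for the normal equation (CGNE). -/
def CGState.next (W : X →L[ℝ] Y) (u : CGState X Y) : CGState X Y :=
  let α := ‖adjoint W u.r‖ ^ 2 / ‖W u.d‖ ^ 2
  let r' := u.r - α • W u.d
  let β := ‖adjoint W r'‖ ^ 2 / ‖adjoint W u.r‖ ^ 2
  ⟨u.f + α • u.d, r', adjoint W r' + β • u.d⟩

/-- The states of CGNE for `W f = g`, started at `f_0 = 0`. If `W* r_k = 0`, so that `f_k` solves
the normal equation, then `f_{k+1} = f_k`. -/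
def cgState (W : X →L[ℝ] Y) (g : Y) : ℕ → CGState X Y
  | 0 => ⟨0, g - W 0, adjoint W (g - W 0)⟩
  | k + 1 => (cgState W g k).next W

/-- The three iterative methods. -/
inductive Method where
  /-- Landweber's method with step size `γ` -/
  | landweber (γ : ℝ)
  /-- steepest descent -/
  | steepestDescent
  /-- conjugate gradients for the normal equation -/
  | cg

/-- The step size `γ` of Landweber's method satisfies `0 < γ < 2 / ‖W* W‖`. -/
def Method.Admissible (W : X →L[ℝ] Y) : Method → Prop
  | .landweber γ => 0 < γ ∧ γ * ‖adjoint W ∘L W‖ < 2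
  | .steepestDescent => True
  | .cg => True

/-- The iterate `f_k` of the method for the equation `W f = g`. -/
def Method.iterate (W : X →L[ℝ] Y) (g : Y) : Method → ℕ → X
  | .landweber γ, k => PAT.landweber W γ g k
  | .steepestDescent, k => PAT.steepestDescent W g k
  | .cg, k => (cgState W g k).f

/-- The indices `k` that satisfy the discrepancy inequality `‖W f_k - g‖ ≤ τ δ`. -/
def discrepancySet (W : X →L[ℝ] Y) (M : Method) (τ δ : ℝ) (g : Y) : Set ℕ :=
  {k | ‖W (M.iterate W g k) - g‖ ≤ τ * δ}

/-- The stopping index of Morozov's discrepancy principle, the least element of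
`discrepancySet`. -/
def stoppingIndex (W : X →L[ℝ] Y) (M : Method) (τ δ : ℝ) (g : Y) : ℕ :=
  sInf (discrepancySet W M τ δ g)

end Iteration

end PAT

end

/-! ### Abstract convergence criteria in Hilbert spaces. -/

namespace PAT

section Convergence

variable {X Y : Type*} [NormedAddCommGroup X] [InnerProductSpace ℝ X]
  [NormedAddCommGroup Y] [InnerProductSpace ℝ Y]

open ContinuousLinearMap (adjoint)

/-! The argument is pure Hilbert space theory: of the forward operator it takes only that it is
bounded, linear and injective. Write e_k = f - f_k for the errors, η = g - W f for the noise and r_k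
= g - W f_k = W e_k + η for the residuals.

Exact data: for each method the drop ‖e_k‖² - ‖e_{k+1}‖² dominates ‖W e_k‖² and also, up to
constants, the pairing of e_k - e_{k+1} with every later error. The second bound makes the errors a
Cauchy sequence, the first one puts their limit into ker W = 0 (`tendsto_zero_of_energy`).

Noisy data: without a convergence rate, the proof restarts the estimate at a fixed index j where the
exact-data error is small (`IsRegularIteration.discrepancy`). For small noise the first j steps
depend continuously on the data, so the noisy error at j is small too, and stopping before j is
impossible. From j to the stopping index the error grows at most by a factor independent of j and of
the noise, up to a term that vanishes with the noise. `IsRegularIteration` collects these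
properties.

Growth after j. Landweber: the propagated noise after k steps is O(√k δ), while the discrepancy
principle limits k by a multiple of ‖e_j‖²/δ² (`landweber_noise_bound`). Steepest descent: the error
decreases as long as the residual after the step exceeds τδ (`steepestDescent_decrease`), and the
one remaining step has controlled length (`steepestDescent_step_le`). CGNE: each step is W* of a
weighted sum of residuals, and ⟪r_j, r_k⟫ = ‖r_{max(j,k)}‖² makes the needed inner products
explicit. The directions remember the steps before j, but this memory, `cgHistory`, is orthogonal to
all residuals from j on, so it is felt only through the noise (`IsCGSequence.norm_error_sq_le`,
`IsCGSequence.norm_step_le`). -/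

theorem norm_sub_smul_sq {E : Type*} [NormedAddCommGroup E] [InnerProductSpace ℝ E]
    (x y : E) (t : ℝ) :
    ‖x - t • y‖ ^ 2 = ‖x‖ ^ 2 - 2 * t * ⟪x, y⟫_ℝ + t ^ 2 * ‖y‖ ^ 2 := by
  rw [norm_sub_sq_real, real_inner_smul_right, norm_smul, mul_pow, Real.norm_eq_abs, sq_abs]
  ring

theorem norm_apply_sq_le (W : X →L[ℝ] Y) (x : X) : ‖W x‖ ^ 2 ≤ ‖W‖ ^ 2 * ‖x‖ ^ 2 := by
  rw [← mul_pow]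
  exact pow_le_pow_left₀ (norm_nonneg _) (W.le_opNorm x) 2

/-- A sequence of errors whose energy decay controls both the residuals and the increments tends
to zero. -/
theorem tendsto_zero_of_energy [CompleteSpace X] {W : X →L[ℝ] Y} (hW : Function.Injective W) {e : ℕ → X} {c C : ℝ}
    (hc : 0 < c) (h1 : ∀ i, c * ‖W (e i)‖ ^ 2 ≤ ‖e i‖ ^ 2 - ‖e (i + 1)‖ ^ 2)
    (h2 : ∀ i k, i < k →
      |⟪e k, e i - e (i + 1)⟫_ℝ| ≤ C * (‖e i‖ ^ 2 - ‖e (i + 1)‖ ^ 2)) :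
    Tendsto e atTop (𝓝 0) := by
  have anti : Antitone fun k => ‖e k‖ ^ 2 := antitone_nat_of_succ_le fun k => by
    have : 0 ≤ c * ‖W (e k)‖ ^ 2 := by positivity
    linarith [h1 k]
  have hbdd : BddBelow (Set.range fun k => ‖e k‖ ^ 2) :=
    ⟨0, by rintro _ ⟨k, rfl⟩; exact sq_nonneg ‖e k‖⟩
  have hL := tendsto_atTop_ciInf anti hbdd
  have hle : ∀ k, (⨅ k, ‖e k‖ ^ 2) ≤ ‖e k‖ ^ 2 := fun k => ciInf_le hbdd k
  set L := ⨅ k, ‖e k‖ ^ 2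
  have hsum : ∀ n j, |⟪e (j + n), e j - e (j + n)⟫_ℝ| ≤ C * (‖e j‖ ^ 2 - ‖e (j + n)‖ ^ 2) := by
    intro n
    -- The late index k stays fixed while j moves, because `h2` pairs every earlier increment with
    -- the same late error.
    suffices ∀ k j, j + n = k → |⟪e k, e j - e k⟫_ℝ| ≤ C * (‖e j‖ ^ 2 - ‖e k‖ ^ 2) from
      fun j => this _ j rfl
    induction n with
    | zero => rintro k j rfl; simp
    | succ n ih =>
      intro k j hk
      have e1 := ih k (j + 1) (by omega)
      have e2 := h2 j k (by omega)
      have e3 : e j - e k = (e j - e (j + 1)) + (e (j + 1) - e k) := by abel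
      rw [e3, inner_add_right]
      refine (abs_add_le _ _).trans ((add_le_add e2 e1).trans_eq ?_)
      ring
  have hcau : CauchySeq e := by
    refine cauchySeq_of_le_tendsto_0' (fun n => √((1 + 2 * |C|) * (‖e n‖ ^ 2 - L))) ?_ ?_
    · intro j k hjk
      obtain ⟨n, rfl⟩ := Nat.exists_eq_add_of_le hjk
      rw [dist_eq_norm]
      refine Real.le_sqrt_of_sq_le ?_
      have e1 : ‖e j - e (j + n)‖ ^ 2 = ‖e j‖ ^ 2 - ‖e (j + n)‖ ^ 2
          - 2 * ⟪e (j + n), e j - e (j + n)⟫_ℝ := by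
        rw [norm_sub_sq_real, inner_sub_right, real_inner_self_eq_norm_sq, real_inner_comm]
        ring
      have e2 := (abs_le.1 (hsum n j)).1
      have e3 := anti hjk
      have e4 := hle (j + n)
      simp only at e3
      have e5 : C * (‖e j‖ ^ 2 - ‖e (j + n)‖ ^ 2) ≤ |C| * (‖e j‖ ^ 2 - ‖e (j + n)‖ ^ 2) :=
        mul_le_mul_of_nonneg_right (le_abs_self C) (by linarith)
      have e6 : (1 + 2 * |C|) * (‖e j‖ ^ 2 - ‖e (j + n)‖ ^ 2) ≤
          (1 + 2 * |C|) * (‖e j‖ ^ 2 - L) :=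
        mul_le_mul_of_nonneg_left (by linarith) (by positivity)
      linarith
    · have := ((hL.sub_const L).const_mul (1 + 2 * |C|)).sqrt
      simpa using this
  obtain ⟨x, hx⟩ := cauchySeq_tendsto_of_complete hcau
  have hWx : Tendsto (fun k => W (e k)) atTop (𝓝 (W x)) := (W.continuous.tendsto x).comp hx
  have hz : Tendsto (fun k => c * ‖W (e k)‖ ^ 2) atTop (𝓝 0) := by
    have h3 : Tendsto (fun k => ‖e k‖ ^ 2 - ‖e (k + 1)‖ ^ 2) atTop (𝓝 (L - L)) :=
      hL.sub (hL.comp (tendsto_add_atTop_nat 1))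
    rw [sub_self] at h3
    exact squeeze_zero (fun k => by positivity) h1 h3
  have h4 := tendsto_nhds_unique hz ((hWx.norm.pow 2).const_mul c)
  have h5 : W x = 0 := by
    rcases mul_eq_zero.1 h4.symm with h | h
    · exact absurd h hc.ne'
    · simpa using h
  rwa [(map_eq_zero_iff W hW).1 h5] at hx

theorem apply_error_add_noise (W : X →L[ℝ] Y) (f x : X) (g : Y) :
    W (f - x) + (g - W f) = g - W x := by
  rw [map_sub]
  abel

/-- The properties of an iterative method `F`, which sends data `g` to the iterates `F g k`, that
make the discrepancy principle a convergent stopping rule for the solution `f`. -/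
structure IsRegularIteration (W : X →L[ℝ] Y) (F : Y → ℕ → X) (f : X) : Prop where
  exact_data : Tendsto (F (W f)) atTop (𝓝 f)
  stable : ∀ j, (∀ l < j, F (W f) l ≠ f) → Tendsto (fun g => F g j) (𝓝 (W f)) (𝓝 (F (W f) j))
  stops : ∀ (τ δ : ℝ) (g : Y), 1 < τ → 0 < δ → ‖g - W f‖ ≤ δ → ∃ k, ‖W (F g k) - g‖ ≤ τ * δ
  error_bound : ∀ τ : ℝ, 1 < τ → ∃ C : ℝ, 0 < C ∧ ∀ j, (∀ l < j, F (W f) l ≠ f) →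
    ∃ b : ℝ → Y → ℝ, Tendsto (fun z : ℝ × Y => b z.1 z.2) (𝓝 0 ×ˢ 𝓝 (W f)) (𝓝 0) ∧
      ∀ (δ : ℝ) (g : Y) (n : ℕ), 0 < δ → ‖g - W f‖ ≤ δ → j ≤ n →
        (∀ k < n, τ * δ < ‖W (F g k) - g‖) → ‖F g n - f‖ ≤ C * ‖F g j - f‖ + b δ g

/-- Convergence of an iterative method that is stopped by the discrepancy principle. -/
theorem IsRegularIteration.discrepancy {W : X →L[ℝ] Y} (hW : Function.Injective W)
    {F : Y → ℕ → X} {f : X} (hF : IsRegularIteration W F f) {τ : ℝ} (hτ : 1 < τ) {δ : ℕ → ℝ}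
    {g : ℕ → Y} (hδ : ∀ m, 0 < δ m) (hδ0 : Tendsto δ atTop (𝓝 0))
    (hg : ∀ m, ‖g m - W f‖ ≤ δ m) :
    (∀ m, IsLeast {k | ‖W (F (g m) k) - g m‖ ≤ τ * δ m}
      (sInf {k | ‖W (F (g m) k) - g m‖ ≤ τ * δ m})) ∧
    Tendsto (fun m => ‖F (g m) (sInf {k | ‖W (F (g m) k) - g m‖ ≤ τ * δ m}) - f‖)
      atTop (𝓝 0) := by
  have hleast : ∀ m, IsLeast {k | ‖W (F (g m) k) - g m‖ ≤ τ * δ m}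
      (sInf {k | ‖W (F (g m) k) - g m‖ ≤ τ * δ m}) := fun m =>
    ⟨Nat.sInf_mem (hF.stops τ (δ m) (g m) hτ (hδ m) (hg m)), fun k hk => Nat.sInf_le hk⟩
  refine ⟨hleast, ?_⟩
  choose N hN using fun m : ℕ =>
    (⟨_, rfl⟩ : ∃ n, n = sInf {k | ‖W (F (g m) k) - g m‖ ≤ τ * δ m})
  simp only [← hN] at hleast ⊢
  have hbefore : ∀ m, ∀ k < N m, τ * δ m < ‖W (F (g m) k) - g m‖ := fun m k hk =>
    lt_of_not_ge fun h => absurd ((hleast m).2 h) (not_le.2 hk)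
  have hgf : Tendsto g atTop (𝓝 (W f)) := by
    rw [tendsto_iff_norm_sub_tendsto_zero]
    exact squeeze_zero (fun m => norm_nonneg _) hg hδ0
  obtain ⟨C, hC, hbound⟩ := hF.error_bound τ hτ
  rw [Metric.tendsto_atTop']
  intro ε hε
  -- The final bound is C ε' + ε' = ε / 2.
  set ε' := ε / (2 * C + 2)
  have hε' : 0 < ε' := by positivity
  have hexists : ∃ j, ‖F (W f) j - f‖ < ε' := by
    have := (tendsto_iff_norm_sub_tendsto_zero.1 hF.exact_data).eventually_lt_const hε'
    exact this.exists
  classical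
  let j := Nat.find hexists
  have hj : ‖F (W f) j - f‖ < ε' := Nat.find_spec hexists
  have hjmin : ∀ l < j, ε' ≤ ‖F (W f) l - f‖ := fun l hl =>
    not_lt.1 (Nat.find_min hexists hl)
  -- This is why j is taken minimal: before j the exact iteration has not terminated, so the
  -- iterates up to j are stable at the exact data.
  have hne : ∀ l < j, F (W f) l ≠ f := fun l hl h => by
    have := hjmin l hl
    rw [h, sub_self, norm_zero] at this
    linarith
  have hstab : ∀ i ≤ j, Tendsto (fun m => F (g m) i) atTop (𝓝 (F (W f) i)) := fun i hi =>
    (hF.stable i fun l hl => hne l (hl.trans_le hi)).comp hgf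
  obtain ⟨b, hb, hbj⟩ := hbound j hne
  have hb' : Tendsto (fun m => b (δ m) (g m)) atTop (𝓝 0) := hb.comp (hδ0.prodMk hgf)
  have ev1 : ∀ᶠ m in atTop, b (δ m) (g m) < ε' := hb'.eventually_lt_const hε'
  have ev2 : ∀ᶠ m in atTop, ‖F (g m) j - f‖ < ε' :=
    (((hstab j le_rfl).sub_const f).norm).eventually_lt_const hj
  -- By injectivity the residuals at the finitely many indices below j have nonzero limits, while τ
  -- δ tends to 0; hence no early stop.
  have ev3 : ∀ᶠ m in atTop, ∀ i ∈ Finset.range j, N m ≠ i := by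
    rw [Finset.eventually_all]
    intro i hi
    have hij : i < j := Finset.mem_range.1 hi
    have h1 : Tendsto (fun m => ‖W (F (g m) i) - g m‖) atTop (𝓝 ‖W (F (W f) i) - W f‖) :=
      (((W.continuous.tendsto _).comp (hstab i hij.le)).sub hgf).norm
    have h2 : Tendsto (fun m => τ * δ m) atTop (𝓝 0) := by simpa using hδ0.const_mul τ
    have h3 : 0 < ‖W (F (W f) i) - W f‖ :=
      norm_pos_iff.2 (sub_ne_zero.2 fun h => hne i hij (hW h))
    filter_upwards [h2.eventually_lt h1 h3] with m hm hNm
    have := (hleast m).1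
    simp only [Set.mem_ofPred_eq, hNm] at this
    linarith
  obtain ⟨m₀, hm₀⟩ := eventually_atTop.1 (ev1.and (ev2.and ev3))
  refine ⟨m₀, fun m hm => ?_⟩
  obtain ⟨h1, h2, h3⟩ := hm₀ m hm.le
  have hjN : j ≤ N m := by
    by_contra h
    exact h3 (N m) (Finset.mem_range.2 (not_le.1 h)) rfl
  have h4 := hbj (δ m) (g m) (N m) (hδ m) (hg m) hjN (hbefore m)
  rw [dist_zero_right, norm_norm]
  have h5 : C * ‖F (g m) j - f‖ ≤ C * ε' := mul_le_mul_of_nonneg_left h2.le hC.le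
  have h6 : (2 * C + 2) * ε' = ε := mul_div_cancel₀ _ (by positivity)
  nlinarith

variable [CompleteSpace X] [CompleteSpace Y]

theorem norm_adjoint_apply_sq_le (W : X →L[ℝ] Y) (y : Y) :
    ‖adjoint W y‖ ^ 2 ≤ ‖W‖ ^ 2 * ‖y‖ ^ 2 := by
  simpa using norm_apply_sq_le (adjoint W) y

/-- For exact data a vanishing gradient means a vanishing error; the denominators of the step sizes
are nonzero for this reason. -/
theorem adjoint_apply_eq_zero_iff {W : X →L[ℝ] Y} (hW : Function.Injective W) {x : X} :
    adjoint W (W x) = 0 ↔ x = 0 := by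
  refine ⟨fun h => hW ?_, fun h => by simp [h]⟩
  have h1 : ⟪adjoint W (W x), x⟫_ℝ = ‖W x‖ ^ 2 := by
    rw [ContinuousLinearMap.adjoint_inner_left, real_inner_self_eq_norm_sq]
  rw [h, inner_zero_left] at h1
  simpa using h1.symm

/-! ### Landweber's method -/

/-- The spectrum of γ W W* lies in [0, 2), so I - γ W W* is nonexpansive. It propagates noise-free
residuals as well as the noise part of the residual. -/
theorem norm_landweber_residual_le {W : X →L[ℝ] Y} {γ : ℝ} (hγ : 0 < γ)
    (hγW : γ * ‖W‖ ^ 2 < 2) (y : Y) : ‖y - γ • W (adjoint W y)‖ ≤ ‖y‖ := by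
  refine le_of_sq_le_sq ?_ (norm_nonneg _)
  rw [norm_sub_smul_sq, ← ContinuousLinearMap.adjoint_inner_left, real_inner_self_eq_norm_sq]
  have h1 := norm_apply_sq_le W (adjoint W y)
  have h2 : γ ^ 2 * ‖W (adjoint W y)‖ ^ 2 ≤ γ * (γ * ‖W‖ ^ 2) * ‖adjoint W y‖ ^ 2 := by
    calc _ ≤ γ ^ 2 * (‖W‖ ^ 2 * ‖adjoint W y‖ ^ 2) := by gcongr
      _ = _ := by ring
  have h3 : γ * (γ * ‖W‖ ^ 2) * ‖adjoint W y‖ ^ 2 ≤ γ * 2 * ‖adjoint W y‖ ^ 2 := by gcongr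
  linarith

theorem landweber_energy {W : X →L[ℝ] Y} {γ : ℝ} (hγ : 0 < γ) (x : X) :
    γ * (2 - γ * ‖W‖ ^ 2) * ‖W x‖ ^ 2 ≤ ‖x‖ ^ 2 - ‖x - γ • adjoint W (W x)‖ ^ 2 := by
  rw [norm_sub_smul_sq, ContinuousLinearMap.adjoint_inner_right, real_inner_self_eq_norm_sq]
  have h1 := norm_adjoint_apply_sq_le W (W x)
  have h2 : γ ^ 2 * ‖adjoint W (W x)‖ ^ 2 ≤ γ ^ 2 * (‖W‖ ^ 2 * ‖W x‖ ^ 2) := by gcongr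
  linarith

/-- Noise propagation for Landweber's method before the discrepancy principle is met. -/
theorem landweber_noise_bound {W : X →L[ℝ] Y} {γ : ℝ} (hγ : 0 < γ) (hγW : γ * ‖W‖ ^ 2 < 2)
    {e : ℕ → X} {η : Y} {δ τ : ℝ} (hδ : 0 < δ) (hη : ‖η‖ ≤ δ) (hτ : 1 < τ)
    (he : ∀ k, e (k + 1) = e k - γ • adjoint W (W (e k) + η)) {n : ℕ}
    (hn : ∀ k < n, τ * δ < ‖W (e k) + η‖) :
    n * (γ * (2 - γ * ‖W‖ ^ 2)) * ((τ - 1) ^ 2 * δ ^ 2) ≤ ‖e 0‖ ^ 2 ∧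
      ‖e n‖ ≤ ‖e 0‖ + √(2 * γ * n * δ ^ 2) := by
  -- The noise-free iteration with the same initial error; the difference e - h is driven by η alone
  -- and starts at 0.
  let h : ℕ → X := fun k => (fun x => x - γ • adjoint W (W x))^[k] (e 0)
  have h_succ : ∀ k, h (k + 1) = h k - γ • adjoint W (W (h k)) := fun k =>
    Function.iterate_succ_apply' _ _ _
  have hκ : 0 < γ * (2 - γ * ‖W‖ ^ 2) := mul_pos hγ (by linarith)
  set κ := γ * (2 - γ * ‖W‖ ^ 2)
  have energy : ∀ k, κ * ‖W (h k)‖ ^ 2 ≤ ‖h k‖ ^ 2 - ‖h (k + 1)‖ ^ 2 := fun k => by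
    rw [h_succ]
    exact landweber_energy hγ (h k)
  have mono : ∀ k, ‖W (h (k + 1))‖ ≤ ‖W (h k)‖ := fun k => by
    rw [h_succ, map_sub, map_smul]
    exact norm_landweber_residual_le hγ hγW _
  -- The energy drops are summed, each bounded below by the latest residual because of `mono`.
  have decay : ∀ k : ℕ, k * κ * ‖W (h k)‖ ^ 2 ≤ ‖e 0‖ ^ 2 - ‖h k‖ ^ 2 := by
    intro k
    induction k with
    | zero => simp [h]
    | succ k ih =>
      have e1 : ((k + 1 : ℕ) : ℝ) * κ * ‖W (h (k + 1))‖ ^ 2 ≤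
          ((k + 1 : ℕ) : ℝ) * κ * ‖W (h k)‖ ^ 2 := by
        gcongr
        exact mono k
      have e2 := energy k
      push_cast at e1 ⊢
      linarith
  have noise_res : ∀ k, ‖W (e k - h k) + η‖ ≤ δ := by
    intro k
    induction k with
    | zero => simpa [h] using hη
    | succ k ih =>
      have e1 : W (e (k + 1) - h (k + 1)) + η =
          (W (e k - h k) + η) - γ • W (adjoint W (W (e k - h k) + η)) := by
        rw [he, h_succ]
        simp only [map_sub, map_add, map_smul, smul_sub, smul_add]
        abel
      rw [e1]
      exact (norm_landweber_residual_le hγ hγW _).trans ih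
  have noise : ∀ k : ℕ, ‖e k - h k‖ ^ 2 ≤ 2 * γ * k * δ ^ 2 := by
    intro k
    induction k with
    | zero => simp [h]
    | succ k ih =>
      set ν := e k - h k with hν
      set ρ := W ν + η with hρ
      have e1 : e (k + 1) - h (k + 1) = ν - γ • adjoint W ρ := by
        rw [he, h_succ, hρ, hν]
        simp only [map_sub, map_add, smul_sub, smul_add]
        abel
      have e2 : ⟪ν, adjoint W ρ⟫_ℝ = ‖ρ‖ ^ 2 - ⟪η, ρ⟫_ℝ := by
        rw [ContinuousLinearMap.adjoint_inner_right, ← real_inner_self_eq_norm_sq,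
          ← inner_sub_left]
        congr 1
        rw [hρ]
        abel
      have e3 : ⟪η, ρ⟫_ℝ ≤ δ * δ := (real_inner_le_norm _ _).trans
        (mul_le_mul hη (noise_res k) (norm_nonneg _) hδ.le)
      have e4 : γ ^ 2 * ‖adjoint W ρ‖ ^ 2 ≤ γ * 2 * ‖ρ‖ ^ 2 := by
        calc _ ≤ γ ^ 2 * (‖W‖ ^ 2 * ‖ρ‖ ^ 2) := by
              gcongr
              exact norm_adjoint_apply_sq_le W ρ
          _ = γ * (γ * ‖W‖ ^ 2) * ‖ρ‖ ^ 2 := by ring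
          _ ≤ _ := by gcongr
      rw [e1, norm_sub_smul_sq, e2]
      push_cast
      nlinarith
  refine ⟨?_, ?_⟩
  · rcases n with _ | n
    · simp
    -- The discrepancy inequality still fails at n, one index before the end. Noise accounts for at
    -- most δ of that residual, which leaves at least (τ - 1) δ for W (h n).
    · have e1 : W (e n) + η = W (h n) + (W (e n - h n) + η) := by
        rw [map_sub]
        abel
      have e2 := hn n (Nat.lt_succ_self n)
      rw [e1] at e2
      have e3 := (norm_add_le _ _).trans (add_le_add_right (noise_res n) ‖W (h n)‖)
      have e4 : ((τ - 1) * δ) ^ 2 ≤ ‖W (h n)‖ ^ 2 :=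
        pow_le_pow_left₀ (mul_nonneg (by linarith) hδ.le) (by linarith) 2
      rw [mul_pow] at e4
      have e5 := decay n
      have e6 := energy n
      calc ((n + 1 : ℕ) : ℝ) * κ * ((τ - 1) ^ 2 * δ ^ 2)
          ≤ ((n + 1 : ℕ) : ℝ) * κ * ‖W (h n)‖ ^ 2 := by gcongr
        _ ≤ ‖e 0‖ ^ 2 := by
          push_cast
          linarith [sq_nonneg ‖h (n + 1)‖]
  · have e1 : ‖h n‖ ≤ ‖e 0‖ := by
      refine le_of_sq_le_sq ?_ (norm_nonneg _)
      have : 0 ≤ n * κ * ‖W (h n)‖ ^ 2 := by positivity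
      linarith [decay n]
    calc ‖e n‖ = ‖h n + (e n - h n)‖ := by congr 1; abel
      _ ≤ ‖h n‖ + ‖e n - h n‖ := norm_add_le _ _
      _ ≤ _ := add_le_add e1 (Real.le_sqrt_of_sq_le (noise n))

theorem landweber_error_succ (W : X →L[ℝ] Y) (γ : ℝ) (f : X) (g : Y) (k : ℕ) :
    f - landweber W γ g (k + 1) = f - landweber W γ g k -
      γ • adjoint W (W (f - landweber W γ g k) + (g - W f)) := by
  have : W (f - landweber W γ g k) + (g - W f) = -(W (landweber W γ g k) - g) := by
    rw [map_sub]
    abel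
  rw [this, landweber, map_neg, smul_neg]
  abel

theorem isRegularIteration_landweber {W : X →L[ℝ] Y} (hW : Function.Injective W) {γ : ℝ}
    (hγ : 0 < γ) (hγW : γ * ‖W‖ ^ 2 < 2) (f : X) :
    IsRegularIteration W (fun g => landweber W γ g) f := by
  have hκ : 0 < γ * (2 - γ * ‖W‖ ^ 2) := mul_pos hγ (by linarith)
  refine ⟨?_, ?_, ?_, ?_⟩
  · have hs : ∀ k, f - landweber W γ (W f) (k + 1) = f - landweber W γ (W f) k -
        γ • adjoint W (W (f - landweber W γ (W f) k)) := fun k => by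
      simpa using landweber_error_succ W γ f (W f) k
    set e : ℕ → X := fun k => f - landweber W γ (W f) k with he
    have energy : ∀ k, γ * (2 - γ * ‖W‖ ^ 2) * ‖W (e k)‖ ^ 2 ≤ ‖e k‖ ^ 2 - ‖e (k + 1)‖ ^ 2 :=
      fun k => (landweber_energy hγ (e k)).trans_eq (by simp only [he, hs k])
    have mono : Antitone fun k => ‖W (e k)‖ := antitone_nat_of_succ_le fun k => by
      simp only [he, hs, map_sub W _ (γ • _), map_smul W γ]
      exact norm_landweber_residual_le hγ hγW _
    have lim : Tendsto e atTop (𝓝 0) := by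
      refine tendsto_zero_of_energy hW hκ energy (C := γ / (γ * (2 - γ * ‖W‖ ^ 2)))
        fun i k hik => ?_
      have e1 : e i - e (i + 1) = γ • adjoint W (W (e i)) := by
        simp only [he, hs]
        abel
      rw [e1, real_inner_smul_right, ContinuousLinearMap.adjoint_inner_right, abs_mul,
        abs_of_pos hγ]
      calc γ * |⟪W (e k), W (e i)⟫_ℝ| ≤ γ * (‖W (e i)‖ * ‖W (e i)‖) := by
            gcongr
            exact (abs_real_inner_le_norm _ _).trans
              (mul_le_mul_of_nonneg_right (mono hik.le) (norm_nonneg _))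
        _ = γ / (γ * (2 - γ * ‖W‖ ^ 2)) * (γ * (2 - γ * ‖W‖ ^ 2) * ‖W (e i)‖ ^ 2) := by
            rw [div_mul_eq_mul_div, eq_div_iff hκ.ne']
            ring
        _ ≤ _ := by
            gcongr
            exact energy i
    simpa [he] using lim.const_sub f
  · intro j hj
    clear hj
    refine Continuous.tendsto ?_ _
    induction j with
    | zero => simpa only [landweber] using continuous_const
    | succ k ih =>
      simp only [landweber]
      fun_prop
  · intro τ δ g hτ hδ hg
    by_contra! hcon
    obtain ⟨n, hn⟩ := exists_nat_gt
      (‖f‖ ^ 2 / (γ * (2 - γ * ‖W‖ ^ 2) * ((τ - 1) ^ 2 * δ ^ 2)))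
    have h1 := (landweber_noise_bound hγ hγW (e := fun k => f - landweber W γ g k) hδ hg hτ
      (landweber_error_succ W γ f g) (n := n) fun k _ => by
        rw [apply_error_add_noise, norm_sub_rev]
        exact hcon k).1
    have hτ' : 0 < τ - 1 := by linarith
    rw [div_lt_iff₀ (by positivity)] at hn
    simp only [landweber, sub_zero] at h1
    linarith
  · intro τ hτ
    have hτ' : 0 < τ - 1 := by linarith
    -- The noise bound is applied to the iteration restarted at j. Its first half bounds l δ² by a
    -- multiple of ‖e_j‖², which turns the noise term √(2 γ l δ²) of the second half into a multiple
    -- of ‖e_j‖.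
    refine ⟨1 + √(2 * γ / (γ * (2 - γ * ‖W‖ ^ 2) * (τ - 1) ^ 2)), by positivity,
      fun j _ => ⟨fun _ _ => 0, tendsto_const_nhds, fun δ g n hδ hg hjn hn => ?_⟩⟩
    obtain ⟨l, rfl⟩ := Nat.exists_eq_add_of_le hjn
    obtain ⟨h1, h2⟩ := landweber_noise_bound hγ hγW
      (e := fun k => f - landweber W γ g (j + k)) hδ hg hτ
      (fun k => landweber_error_succ W γ f g (j + k)) (n := l) fun k hk => by
        rw [apply_error_add_noise, norm_sub_rev]
        exact hn (j + k) (by omega)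
    rw [norm_sub_rev, norm_sub_rev _ f, add_zero, add_mul, one_mul]
    simp only [add_zero] at h1 h2
    refine h2.trans (add_le_add_right ?_ _)
    refine Real.sqrt_le_iff.2 ⟨by positivity, ?_⟩
    rw [mul_pow, Real.sq_sqrt (by positivity), div_mul_eq_mul_div, le_div_iff₀ (by positivity)]
    nlinarith

/-! ### Steepest descent -/

theorem steepestDescent_error_succ (W : X →L[ℝ] Y) (f : X) (g : Y) (k : ℕ) :
    f - steepestDescent W g (k + 1) = f - steepestDescent W g k -
      (‖adjoint W (g - W (steepestDescent W g k))‖ ^ 2 /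
        ‖W (adjoint W (g - W (steepestDescent W g k)))‖ ^ 2) •
          adjoint W (g - W (steepestDescent W g k)) := by
  rw [steepestDescent, ← neg_sub g]
  simp only [map_neg, norm_neg, smul_neg]
  abel

section SteepestDescentStep

variable {W : X →L[ℝ] Y} {e : X} {r η : Y} {γ : ℝ}

/-- The identity survives 0/0: ‖W* r‖² = ⟪r, W W* r⟫ vanishes together with W W* r. -/
theorem steepestDescent_step_mul (hγ : γ = ‖adjoint W r‖ ^ 2 / ‖W (adjoint W r)‖ ^ 2) :
    γ * ‖W (adjoint W r)‖ ^ 2 = ‖adjoint W r‖ ^ 2 := by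
  by_cases h : W (adjoint W r) = 0
  · have : ⟪r, W (adjoint W r)⟫_ℝ = ‖adjoint W r‖ ^ 2 := by
      rw [← ContinuousLinearMap.adjoint_inner_left, real_inner_self_eq_norm_sq]
    rw [h, inner_zero_right] at this
    rw [← this, h]
    simp
  · rw [hγ, div_mul_cancel₀]
    simpa using h

theorem steepestDescent_residual (hγ : γ = ‖adjoint W r‖ ^ 2 / ‖W (adjoint W r)‖ ^ 2) :
    ‖r - γ • W (adjoint W r)‖ ^ 2 = ‖r‖ ^ 2 - γ * ‖adjoint W r‖ ^ 2 := by
  rw [norm_sub_smul_sq, ← ContinuousLinearMap.adjoint_inner_left, real_inner_self_eq_norm_sq]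
  have := steepestDescent_step_mul hγ
  rw [sq γ, mul_assoc γ γ, this]
  ring

/-- Here ⟪e, W* r⟫ = ‖r‖² - ⟪r, η⟫, and γ² ‖W* r‖² is γ times the drop of the squared residual. -/
theorem steepestDescent_error (hγ : γ = ‖adjoint W r‖ ^ 2 / ‖W (adjoint W r)‖ ^ 2)
    (hr : r = W e + η) :
    ‖e - γ • adjoint W r‖ ^ 2 = ‖e‖ ^ 2 -
      γ * (‖r‖ ^ 2 + ‖r - γ • W (adjoint W r)‖ ^ 2 - 2 * ⟪r, η⟫_ℝ) := by
  have h1 : ⟪e, adjoint W r⟫_ℝ = ‖r‖ ^ 2 - ⟪r, η⟫_ℝ := by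
    rw [ContinuousLinearMap.adjoint_inner_right, ← real_inner_self_eq_norm_sq, ← inner_sub_right,
      real_inner_comm]
    congr 1
    rw [hr]
    abel
  rw [steepestDescent_residual hγ, norm_sub_smul_sq, h1]
  ring

theorem steepestDescent_one_le (hγ : γ = ‖adjoint W r‖ ^ 2 / ‖W (adjoint W r)‖ ^ 2)
    (hs : adjoint W r ≠ 0) : 1 ≤ ‖W‖ ^ 2 * γ := by
  have h1 := norm_apply_sq_le W (adjoint W r)
  have h2 := steepestDescent_step_mul hγ
  have h3 : 0 < ‖adjoint W r‖ ^ 2 := by positivity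
  have h4 : 0 ≤ γ := by
    rw [hγ]
    positivity
  nlinarith

/-- Above the threshold, η is at most the fraction 1/τ of the residual, so ⟪e, W* r⟫ = ‖r‖² - ⟪r, η⟫
keeps the fraction 1 - 1/τ of ‖r‖². -/
theorem inner_residual_le {δ τ : ℝ} (hτ : 1 < τ) (hη : ‖η‖ ≤ δ) (hr : r = W e + η)
    (hres : τ * δ < ‖r‖) : (τ - 1) * ‖r‖ ^ 2 ≤ τ * ⟪e, adjoint W r⟫_ℝ := by
  have h1 : ⟪e, adjoint W r⟫_ℝ = ‖r‖ ^ 2 - ⟪r, η⟫_ℝ := by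
    rw [ContinuousLinearMap.adjoint_inner_right, ← real_inner_self_eq_norm_sq, ← inner_sub_right,
      real_inner_comm]
    congr 1
    rw [hr]
    abel
  have h2 : ⟪r, η⟫_ℝ ≤ ‖r‖ * δ :=
    (real_inner_le_norm _ _).trans (mul_le_mul_of_nonneg_left hη (norm_nonneg _))
  rw [h1]
  nlinarith [norm_nonneg r]

theorem adjoint_residual_ne_zero {δ τ : ℝ} (hτ : 1 < τ) (hδ : 0 < δ) (hη : ‖η‖ ≤ δ)
    (hr : r = W e + η) (hres : τ * δ < ‖r‖) : adjoint W r ≠ 0 := fun h => by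
  have h1 := inner_residual_le hτ hη hr hres
  rw [h, inner_zero_right, mul_zero] at h1
  have h2 : 0 < τ * δ := mul_pos (by linarith) hδ
  have h3 : 0 < (τ - 1) * ‖r‖ ^ 2 := mul_pos (by linarith) (pow_pos (h2.trans hres) 2)
  linarith

/-- Combines γ ‖W* r‖² ≤ ‖r‖² with `inner_residual_le`. Only the residual before the step has to
exceed the threshold, so the final step before stopping is covered. -/
theorem steepestDescent_step_le (hγ : γ = ‖adjoint W r‖ ^ 2 / ‖W (adjoint W r)‖ ^ 2)
    {δ τ : ℝ} (hτ : 1 < τ) (hδ : 0 < δ) (hη : ‖η‖ ≤ δ)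
    (hr : r = W e + η) (hres : τ * δ < ‖r‖) : ‖γ • adjoint W r‖ ≤ τ / (τ - 1) * ‖e‖ := by
  have hτ' : 0 < τ - 1 := by linarith
  have h1 := (inner_residual_le hτ hη hr hres).trans
    (mul_le_mul_of_nonneg_left (real_inner_le_norm _ _) (by linarith))
  have h2 := sq_nonneg ‖r - γ • W (adjoint W r)‖
  rw [steepestDescent_residual hγ] at h2
  have hs : 0 < ‖adjoint W r‖ := norm_pos_iff.2 (adjoint_residual_ne_zero hτ hδ hη hr hres)
  have h4 : 0 ≤ γ := by
    rw [hγ]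
    positivity
  rw [norm_smul, Real.norm_of_nonneg h4, div_mul_eq_mul_div, le_div_iff₀ hτ']
  refine le_of_mul_le_mul_right ?_ hs
  nlinarith

/-- With r' the new residual, ‖r‖² + ‖r'‖² - 2 δ ‖r‖ = (‖r‖ - δ)² + ‖r'‖² - δ², so only the residual
after the step has to exceed the threshold. -/
theorem steepestDescent_decrease (hγ : γ = ‖adjoint W r‖ ^ 2 / ‖W (adjoint W r)‖ ^ 2)
    {δ τ : ℝ} (hτ : 1 < τ) (hδ : 0 < δ) (hη : ‖η‖ ≤ δ) (hr : r = W e + η)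
    (hres : τ * δ < ‖r - γ • W (adjoint W r)‖) :
    ‖e - γ • adjoint W r‖ ^ 2 ≤ ‖e‖ ^ 2 - γ * ((τ ^ 2 - 1) * δ ^ 2) := by
  have h4 : 0 ≤ γ := by
    rw [hγ]
    positivity
  have h2 : ⟪r, η⟫_ℝ ≤ ‖r‖ * δ :=
    (real_inner_le_norm _ _).trans (mul_le_mul_of_nonneg_left hη (norm_nonneg _))
  have h3 : (τ * δ) ^ 2 ≤ ‖r - γ • W (adjoint W r)‖ ^ 2 :=
    pow_le_pow_left₀ (mul_nonneg (by linarith) hδ.le) hres.le 2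
  rw [steepestDescent_error hγ hr]
  refine sub_le_sub_left (mul_le_mul_of_nonneg_left ?_ h4) _
  nlinarith [sq_nonneg (‖r‖ - δ)]

end SteepestDescentStep

theorem isRegularIteration_steepestDescent {W : X →L[ℝ] Y} (hW : Function.Injective W) (f : X) :
    IsRegularIteration W (fun g => steepestDescent W g) f := by
  have hexists : ∀ g : Y, ∃ (γ : ℕ → ℝ) (r : ℕ → Y),
      (∀ k, γ k = ‖adjoint W (r k)‖ ^ 2 / ‖W (adjoint W (r k))‖ ^ 2) ∧
      (∀ k, r k = g - W (steepestDescent W g k)) ∧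
      (∀ k, r k = W (f - steepestDescent W g k) + (g - W f)) ∧
      (∀ k, f - steepestDescent W g (k + 1) =
        f - steepestDescent W g k - γ k • adjoint W (r k)) ∧
      (∀ k, r (k + 1) = r k - γ k • W (adjoint W (r k))) := by
    intro g
    refine ⟨fun k => _, fun k => g - W (steepestDescent W g k), fun k => rfl, fun k => rfl,
      fun k => (apply_error_add_noise _ _ _ _).symm, steepestDescent_error_succ W f g,
      fun k => ?_⟩
    have h1 := apply_error_add_noise W f (steepestDescent W g (k + 1)) g
    rw [steepestDescent_error_succ, map_sub W _ (_ • _), map_smul W, sub_add_eq_add_sub,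
      apply_error_add_noise] at h1
    exact h1.symm
  have hpos : ∀ (γ : ℝ) (r : Y), γ = ‖adjoint W r‖ ^ 2 / ‖W (adjoint W r)‖ ^ 2 → 0 ≤ γ := by
    rintro _ r rfl
    positivity
  refine ⟨?_, ?_, ?_, ?_⟩
  · obtain ⟨γ, r, hγ, -, hr, hs, hrs⟩ := hexists (W f)
    set e : ℕ → X := fun k => f - steepestDescent W (W f) k with he
    have hr' : ∀ k, r k = W (e k) := fun k =>
      (hr k).trans (by rw [sub_self, add_zero])
    have hs' : ∀ k, e (k + 1) = e k - γ k • adjoint W (r k) := hs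
    have herr : ∀ k, ‖e k‖ ^ 2 - ‖e (k + 1)‖ ^ 2 = γ k * (‖r k‖ ^ 2 + ‖r (k + 1)‖ ^ 2) := by
      intro k
      rw [hs', hrs, steepestDescent_error (η := 0) (hγ k) (by rw [hr', add_zero]),
        inner_zero_right]
      ring
    have mono : Antitone fun k => ‖r k‖ := antitone_nat_of_succ_le fun k => by
      refine le_of_sq_le_sq ?_ (norm_nonneg _)
      rw [hrs, steepestDescent_residual (hγ k)]
      have := mul_nonneg (hpos _ _ (hγ k)) (sq_nonneg ‖adjoint W (r k)‖)
      linarith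
    have lim : Tendsto e atTop (𝓝 0) := by
      -- The step sizes are at least 1/‖W‖² while the gradient is nonzero; adding 1 covers W = 0.
      refine tendsto_zero_of_energy hW (c := (‖W‖ ^ 2 + 1)⁻¹) (C := 1) (by positivity)
        (fun k => ?_) fun i k hik => ?_
      · rw [herr, ← hr', inv_mul_le_iff₀ (by positivity)]
        have h0 := hpos _ _ (hγ k)
        by_cases h : adjoint W (r k) = 0
        · rw [hr', adjoint_apply_eq_zero_iff hW] at h
          rw [hr', h, map_zero, norm_zero, zero_pow two_ne_zero]
          positivity
        · have h1 := steepestDescent_one_le (hγ k) h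
          have h2 : 1 * ‖r k‖ ^ 2 ≤ ((‖W‖ ^ 2 + 1) * γ k) * ‖r k‖ ^ 2 := by
            gcongr
            linarith
          have h3 : 0 ≤ ((‖W‖ ^ 2 + 1) * γ k) * ‖r (k + 1)‖ ^ 2 := by positivity
          linarith
      · have e1 : e i - e (i + 1) = γ i • adjoint W (r i) := by
          rw [hs']
          abel
        have h0 := hpos _ _ (hγ i)
        rw [herr, e1, real_inner_smul_right, ContinuousLinearMap.adjoint_inner_right, abs_mul,
          abs_of_nonneg h0, one_mul, ← hr']
        refine mul_le_mul_of_nonneg_left ?_ h0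
        have h1 := (abs_real_inner_le_norm (r k) (r i)).trans
          (mul_le_mul_of_nonneg_right (mono hik.le) (norm_nonneg _))
        linarith [sq_nonneg ‖r (i + 1)‖, sq ‖r i‖]
    simpa [he] using lim.const_sub f
  · intro j
    induction j with
    | zero => intro _; simpa only [steepestDescent] using tendsto_const_nhds
    | succ k ih =>
      intro hj
      have h1 := ih fun l hl => hj l (by omega)
      have hr : Tendsto (fun g => W (steepestDescent W g k) - g) (𝓝 (W f))
          (𝓝 (W (steepestDescent W (W f) k) - W f)) :=
        ((W.continuous.tendsto _).comp h1).sub tendsto_id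
      have hs := ((adjoint W).continuous.tendsto _).comp hr
      have hWs := (W.continuous.tendsto _).comp hs
      have hne : ‖W (adjoint W (W (steepestDescent W (W f) k) - W f))‖ ^ 2 ≠ 0 := by
        rw [← map_sub]
        refine pow_ne_zero 2 (norm_ne_zero_iff.2 ?_)
        rw [Ne, map_eq_zero_iff W hW, adjoint_apply_eq_zero_iff hW, sub_eq_zero]
        exact hj k (Nat.lt_succ_self k)
      simp only [steepestDescent]
      exact h1.sub (((hs.norm.pow 2).div (hWs.norm.pow 2) hne).smul hs)
  · intro τ δ g hτ hδ hg
    by_contra! hcon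
    obtain ⟨γ, r, hγ, hrg, hr, hs, hrs⟩ := hexists g
    have hres : ∀ k, τ * δ < ‖r k‖ := fun k => by
      rw [hrg, norm_sub_rev]
      exact hcon k
    have hτ' : 0 < (τ ^ 2 - 1) * δ ^ 2 := mul_pos (by nlinarith) (by positivity)
    have key : ∀ n : ℕ, n * ((‖W‖ ^ 2 + 1)⁻¹ * ((τ ^ 2 - 1) * δ ^ 2)) ≤
        ‖f‖ ^ 2 - ‖f - steepestDescent W g n‖ ^ 2 := by
      intro n
      induction n with
      | zero => simp [steepestDescent]
      | succ n ih =>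
        have h1 := steepestDescent_decrease (hγ n) hτ hδ hg (hr n) (hrs n ▸ hres (n + 1))
        rw [← hs] at h1
        have h2 := steepestDescent_one_le (hγ n)
          (adjoint_residual_ne_zero hτ hδ hg (hr n) (hres n))
        have h3 : (‖W‖ ^ 2 + 1)⁻¹ ≤ γ n := by
          rw [inv_le_iff_one_le_mul₀' (by positivity)]
          linarith [hpos _ _ (hγ n)]
        have h4 := mul_le_mul_of_nonneg_right h3 hτ'.le
        push_cast
        linarith
    obtain ⟨n, hn⟩ := exists_nat_gt (‖f‖ ^ 2 / ((‖W‖ ^ 2 + 1)⁻¹ * ((τ ^ 2 - 1) * δ ^ 2)))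
    rw [div_lt_iff₀ (by positivity)] at hn
    linarith [key n, sq_nonneg ‖f - steepestDescent W g n‖]
  · intro τ hτ
    have hτ' : 0 < τ - 1 := by linarith
    refine ⟨1 + τ / (τ - 1), by positivity,
      fun j _ => ⟨fun _ _ => 0, tendsto_const_nhds, fun δ g n hδ hg hjn hn => ?_⟩⟩
    obtain ⟨γ, r, hγ, hrg, hr, hs, hrs⟩ := hexists g
    have hres : ∀ k < n, τ * δ < ‖r k‖ := fun k hk => by
      rw [hrg, norm_sub_rev]
      exact hn k hk
    rw [norm_sub_rev, norm_sub_rev _ f, add_zero, add_mul, one_mul]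
    have mono : ∀ l, j + l < n → ‖f - steepestDescent W g (j + l)‖ ≤
        ‖f - steepestDescent W g j‖ := by
      intro l
      induction l with
      | zero => exact fun _ => le_rfl
      | succ l ih =>
        intro hl
        refine le_trans ?_ (ih (by omega))
        refine le_of_sq_le_sq ?_ (norm_nonneg _)
        have h1 := steepestDescent_decrease (hγ (j + l)) hτ hδ hg (hr _)
          (hrs (j + l) ▸ hres (j + l + 1) hl)
        rw [← hs] at h1
        have h2 : 0 ≤ (τ ^ 2 - 1) * δ ^ 2 := mul_nonneg (by nlinarith) (by positivity)
        have := mul_nonneg (hpos _ _ (hγ (j + l))) h2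
        exact h1.trans (by linarith)
    -- The residual at n may already be below the threshold, so monotonicity reaches only n - 1 and
    -- the last step is estimated by its length.
    rcases hjn.eq_or_lt with rfl | hlt
    · have : 0 ≤ τ / (τ - 1) * ‖f - steepestDescent W g j‖ := by positivity
      linarith
    · obtain ⟨l, rfl⟩ := Nat.exists_eq_add_of_lt hlt
      have h1 := mono l (by omega)
      have h2 := steepestDescent_step_le (hγ (j + l)) hτ hδ hg (hr _) (hres _ (by omega))
      rw [hs]
      refine (norm_sub_le _ _).trans (add_le_add h1 (h2.trans ?_))
      gcongr

end Convergence
end PAT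

/-! ### Conjugate gradients for the normal equation. -/

namespace PAT

section ConjugateGradients

variable {X Y : Type*} [NormedAddCommGroup X] [InnerProductSpace ℝ X]
  [NormedAddCommGroup Y] [InnerProductSpace ℝ Y]

open ContinuousLinearMap (adjoint)

theorem inner_sum_smul_le {ι κ : Type*} (s : Finset ι) (t : Finset κ) {v : ι → Y} {v' : κ → Y}
    {c m : ι → ℝ} {c' : κ → ℝ} {r : Y} (hc : ∀ i ∈ s, 0 ≤ c i) (hc' : ∀ j ∈ t, 0 ≤ c' j)
    (h : ∀ i ∈ s, ∀ j ∈ t, ⟪v i, v' j⟫_ℝ ≤ m i * ⟪r, v' j⟫_ℝ) :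
    ⟪∑ i ∈ s, c i • v i, ∑ j ∈ t, c' j • v' j⟫_ℝ ≤
      (∑ i ∈ s, c i * m i) * ⟪r, ∑ j ∈ t, c' j • v' j⟫_ℝ := by
  rw [sum_inner, inner_sum, Finset.sum_mul_sum]
  refine Finset.sum_le_sum fun i hi => ?_
  rw [inner_sum]
  refine Finset.sum_le_sum fun j hj => ?_
  rw [real_inner_smul_left, real_inner_smul_right, real_inner_smul_right]
  have h1 : c i * c' j * ⟪v i, v' j⟫_ℝ ≤ c i * c' j * (m i * ⟪r, v' j⟫_ℝ) :=
    mul_le_mul_of_nonneg_left (h i hi j hj) (mul_nonneg (hc i hi) (hc' j hj))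
  linarith

variable [CompleteSpace X] [CompleteSpace Y]

/-- A step of the form W* y has ‖W* y‖² = ⟪r - r', y⟫, so the error change is expressed by pairings
with y in the data space. It serves single steps and whole blocks of steps. -/
theorem norm_sub_adjoint_sq {W : X →L[ℝ] Y} {e e' : X} {r r' η y : Y} (hr : r = W e + η)
    (hr' : r' = W e' + η) (he : e' = e - adjoint W y) :
    ‖e'‖ ^ 2 = ‖e‖ ^ 2 - ⟪r, y⟫_ℝ - ⟪r', y⟫_ℝ + 2 * ⟪η, y⟫_ℝ := by
  have h1 : ⟪e, adjoint W y⟫_ℝ = ⟪r, y⟫_ℝ - ⟪η, y⟫_ℝ := by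
    rw [ContinuousLinearMap.adjoint_inner_right, hr, inner_add_left]
    ring
  have h2 : ⟪adjoint W y, adjoint W y⟫_ℝ = ⟪r, y⟫_ℝ - ⟪r', y⟫_ℝ := by
    rw [ContinuousLinearMap.adjoint_inner_right, ← inner_sub_left, hr', he, hr]
    congr 1
    simp
  rw [he, norm_sub_sq_real, h1, ← real_inner_self_eq_norm_sq (adjoint W y), h2]
  ring

/-- The errors `e`, residuals `r` and search directions `d` of the conjugate gradient method, with
step sizes `α`, for data with noise `η`. -/
structure IsCGSequence (W : X →L[ℝ] Y) (η : Y) (e : ℕ → X) (r : ℕ → Y) (d : ℕ → X)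
    (α : ℕ → ℝ) : Prop where
  residual : ∀ k, r k = W (e k) + η
  alpha : ∀ k, α k = ‖adjoint W (r k)‖ ^ 2 / ‖W (d k)‖ ^ 2
  error_succ : ∀ k, e (k + 1) = e k - α k • d k
  dir_zero : d 0 = adjoint W (r 0)
  dir_succ : ∀ k, d (k + 1) = adjoint W (r (k + 1)) +
    (‖adjoint W (r (k + 1))‖ ^ 2 / ‖adjoint W (r k)‖ ^ 2) • d k

/-- The weight `‖W* r_j‖⁻²`. -/
noncomputable def cgWeight (W : X →L[ℝ] Y) (r : ℕ → Y) (j : ℕ) : ℝ := (‖adjoint W (r j)‖ ^ 2)⁻¹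

/-- The sum of the weights up to `k`. -/
noncomputable def cgMass (W : X →L[ℝ] Y) (r : ℕ → Y) (k : ℕ) : ℝ := ∑ j ∈ Finset.range (k + 1), cgWeight W r j

/-- The weighted sum of the residuals `r_{max(i, j)}` for `j ≤ k`. -/
noncomputable def cgDual (W : X →L[ℝ] Y) (r : ℕ → Y) (i k : ℕ) : Y :=
  ∑ j ∈ Finset.range (k + 1), cgWeight W r j • r (max i j)

/-- The weighted sum of the differences `r_j - r_i` for `j < i`. -/
noncomputable def cgHistory (W : X →L[ℝ] Y) (r : ℕ → Y) (i : ℕ) : Y :=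
  ∑ j ∈ Finset.range i, cgWeight W r j • (r j - r i)

theorem cgWeight_nonneg (W : X →L[ℝ] Y) (r : ℕ → Y) (j : ℕ) : 0 ≤ cgWeight W r j :=
  inv_nonneg.2 (sq_nonneg _)

theorem cgMass_nonneg (W : X →L[ℝ] Y) (r : ℕ → Y) (k : ℕ) : 0 ≤ cgMass W r k :=
  Finset.sum_nonneg fun j _ => cgWeight_nonneg W r j

theorem cgDual_zero_succ (W : X →L[ℝ] Y) (r : ℕ → Y) (k : ℕ) :
    cgDual W r 0 (k + 1) = cgDual W r 0 k + cgWeight W r (k + 1) • r (k + 1) := by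
  rw [cgDual, Finset.sum_range_succ, ← cgDual, Nat.zero_max]

/-- Separates what the direction remembers from before i, which no longer depends on k, from a part
built only of residuals with index at least i. -/
theorem cgDual_add_cgHistory (W : X →L[ℝ] Y) (r : ℕ → Y) {i k : ℕ} (hik : i ≤ k) :
    cgDual W r 0 k = cgDual W r i k + cgHistory W r i := by
  have h : cgHistory W r i =
      ∑ j ∈ Finset.range (k + 1), cgWeight W r j • (r j - r (max i j)) := by
    rw [cgHistory, ← Finset.sum_subset (Finset.range_mono (hik.trans (Nat.le_succ k)))]
    · refine Finset.sum_congr rfl fun j hj => ?_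
      rw [max_eq_left (Finset.mem_range.1 hj).le]
    · intro j _ hj
      rw [Finset.mem_range, not_lt] at hj
      rw [max_eq_right hj, sub_self, smul_zero]
  rw [h, cgDual, cgDual, ← Finset.sum_add_distrib]
  refine Finset.sum_congr rfl fun j _ => ?_
  rw [← smul_add, Nat.zero_max]
  congr 1
  abel

namespace IsCGSequence

variable {W : X →L[ℝ] Y} {η : Y} {e : ℕ → X} {r : ℕ → Y} {d : ℕ → X} {α : ℕ → ℝ}
  (h : IsCGSequence W η e r d α)

include h

theorem residual_succ (k : ℕ) : r (k + 1) = r k - α k • W (d k) := by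
  rw [h.residual, h.residual, h.error_succ, map_sub, map_smul]
  abel

theorem alpha_mul_of_inner {k : ℕ}
    (hk : ⟪adjoint W (r k), d k⟫_ℝ = ‖adjoint W (r k)‖ ^ 2) :
    α k * ‖W (d k)‖ ^ 2 = ‖adjoint W (r k)‖ ^ 2 := by
  rw [h.alpha]
  by_cases h0 : W (d k) = 0
  · rw [ContinuousLinearMap.adjoint_inner_left, h0, inner_zero_right] at hk
    rw [← hk, h0]
    simp
  · rw [div_mul_cancel₀]
    simpa using h0

theorem inner_grad_dir (k : ℕ) : ⟪adjoint W (r k), d k⟫_ℝ = ‖adjoint W (r k)‖ ^ 2 := by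
  induction k with
  | zero => rw [h.dir_zero, real_inner_self_eq_norm_sq]
  | succ k ih =>
    have h1 : ⟪adjoint W (r (k + 1)), d k⟫_ℝ = 0 := by
      have := h.alpha_mul_of_inner ih
      rw [h.residual_succ, map_sub, inner_sub_left, ih, map_smul, real_inner_smul_left,
        ContinuousLinearMap.adjoint_inner_left, real_inner_self_eq_norm_sq, this, sub_self]
    rw [h.dir_succ, inner_add_right, real_inner_smul_right, h1, real_inner_self_eq_norm_sq]
    ring

theorem alpha_mul (k : ℕ) : α k * ‖W (d k)‖ ^ 2 = ‖adjoint W (r k)‖ ^ 2 :=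
  h.alpha_mul_of_inner (h.inner_grad_dir k)

theorem dir_eq_zero {k : ℕ} (hk : adjoint W (r k) = 0) : d k = 0 := by
  cases k with
  | zero => rw [h.dir_zero, hk]
  | succ k => rw [h.dir_succ, hk]; simp

theorem grad_succ_eq_zero {k : ℕ} (hk : adjoint W (r k) = 0) : adjoint W (r (k + 1)) = 0 := by
  rw [h.residual_succ, h.dir_eq_zero hk, map_zero, smul_zero, sub_zero, hk]

theorem grad_ne_zero_of_le {j k : ℕ} (hjk : j ≤ k) (hk : adjoint W (r k) ≠ 0) :
    adjoint W (r j) ≠ 0 := fun hj => hk <| by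
  induction k, hjk using Nat.le_induction with
  | base => exact hj
  | succ k _ ih =>
    by_contra hne
    exact hne (h.grad_succ_eq_zero (by_contra fun h0 => h0 (ih h0)))

theorem inner_grad_grad_of_inner_dir {y : Y} {k : ℕ} (hy : ∀ j < k, ⟪y, W (d j)⟫_ℝ = 0) :
    ∀ j < k, ⟪adjoint W y, adjoint W (r j)⟫_ℝ = 0 := by
  intro j hj
  cases j with
  | zero => rw [← h.dir_zero, ContinuousLinearMap.adjoint_inner_left, hy 0 hj]
  | succ j =>
    rw [eq_sub_of_add_eq (h.dir_succ j).symm, inner_sub_right, real_inner_smul_right,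
      ContinuousLinearMap.adjoint_inner_left, ContinuousLinearMap.adjoint_inner_left,
      hy _ hj, hy j (by omega)]
    ring

/-- The two relations need a joint induction: the residual relation makes the gradients orthogonal,
and this makes the new direction conjugate to the old ones. -/
theorem orthogonality (k : ℕ) :
    (∀ j < k, ⟪r k, W (d j)⟫_ℝ = 0) ∧ ∀ j < k, ⟪W (d k), W (d j)⟫_ℝ = 0 := by
  induction k with
  | zero => simp
  | succ k ih =>
    have h1 : ∀ j < k + 1, ⟪r (k + 1), W (d j)⟫_ℝ = 0 := by
      intro j hj
      rw [h.residual_succ, inner_sub_left, real_inner_smul_left]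
      rcases Nat.lt_succ_iff_lt_or_eq.1 hj with hj | rfl
      · rw [ih.1 j hj, ih.2 j hj]
        ring
      · rw [← ContinuousLinearMap.adjoint_inner_left, h.inner_grad_dir,
          real_inner_self_eq_norm_sq, h.alpha_mul, sub_self]
    refine ⟨h1, fun j hj => ?_⟩
    have h2 := h.inner_grad_grad_of_inner_dir h1
    by_cases h0 : adjoint W (r (k + 1)) = 0
    · rw [h.dir_eq_zero h0, map_zero, inner_zero_left]
    have hsj : adjoint W (r j) ≠ 0 := h.grad_ne_zero_of_le hj.le h0
    have hαj : α j ≠ 0 := fun h3 => hsj <| by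
      have := h.alpha_mul j
      rw [h3, zero_mul] at this
      simpa using this.symm
    -- α_j W d_j = r_j - r_{j+1}, and the new gradient is orthogonal to the gradient at j. For j < k
    -- the right side vanishes too; for j = k the coefficient of d_k in `dir_succ` cancels it.
    have h3 : α j * ⟪W (adjoint W (r (k + 1))), W (d j)⟫_ℝ =
        - ⟪adjoint W (r (k + 1)), adjoint W (r (j + 1))⟫_ℝ := by
      rw [h.residual_succ j, map_sub, inner_sub_right, h2 j hj, map_smul,
        real_inner_smul_right, ContinuousLinearMap.adjoint_inner_right W _ (W (d j))]
      ring
    refine (mul_eq_zero.1 ?_).resolve_left hαj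
    rw [h.dir_succ, map_add, map_smul, inner_add_left, real_inner_smul_left, mul_add, h3]
    rcases Nat.lt_succ_iff_lt_or_eq.1 hj with hj | rfl
    · rw [ih.2 j hj, h2 (j + 1) (by omega)]
      ring
    · have h4 := h.alpha_mul j
      have h5 : ‖adjoint W (r j)‖ ^ 2 ≠ 0 := by simpa using hsj
      rw [real_inner_self_eq_norm_sq, real_inner_self_eq_norm_sq]
      rw [mul_left_comm, h4, div_mul_cancel₀ _ h5]
      ring

theorem inner_grad_grad {j k : ℕ} (hjk : j < k) :
    ⟪adjoint W (r k), adjoint W (r j)⟫_ℝ = 0 :=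
  h.inner_grad_grad_of_inner_dir (h.orthogonality k).1 j hjk

/-- r_j - r_k is a combination of the W d_l with j ≤ l < k, all orthogonal to r_k. -/
theorem inner_residual_of_le {j k : ℕ} (hjk : j ≤ k) : ⟪r k, r j⟫_ℝ = ‖r k‖ ^ 2 := by
  obtain ⟨n, rfl⟩ := Nat.exists_eq_add_of_le hjk
  suffices ∀ k j, j + n = k → ⟪r k, r j⟫_ℝ = ‖r k‖ ^ 2 from this _ j rfl
  clear hjk
  induction n with
  | zero => rintro k j rfl; exact real_inner_self_eq_norm_sq _
  | succ n ih =>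
    intro k j hk
    have h1 := ih k (j + 1) (by omega)
    rwa [h.residual_succ, inner_sub_right, real_inner_smul_right,
      (h.orthogonality k).1 j (by omega), mul_zero, sub_zero] at h1

theorem inner_residual (j k : ℕ) : ⟪r j, r k⟫_ℝ = ‖r (max j k)‖ ^ 2 := by
  rcases le_total j k with hjk | hjk
  · rw [max_eq_right hjk, real_inner_comm, h.inner_residual_of_le hjk]
  · rw [max_eq_left hjk, h.inner_residual_of_le hjk]

/-- Dividing the recursion by ‖W* r_k‖² makes it telescope: d_k/‖W* r_k‖² grows by W* r_{k+1}/‖W*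
r_{k+1}‖². After termination both sides are 0. -/
theorem dir_eq (k : ℕ) : d k = ‖adjoint W (r k)‖ ^ 2 • adjoint W (cgDual W r 0 k) := by
  have hw : ∀ k, adjoint W (r k) ≠ 0 → ‖adjoint W (r k)‖ ^ 2 * cgWeight W r k = 1 := fun k hk =>
    mul_inv_cancel₀ (by simpa using hk)
  by_cases h0 : adjoint W (r k) = 0
  · rw [h.dir_eq_zero h0, h0]
    simp
  induction k with
  | zero =>
    simp only [cgDual, zero_add, Finset.sum_range_one, max_self, map_smul, smul_smul, hw 0 h0,
      one_smul, h.dir_zero]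
  | succ k ih =>
    have h1 := h.grad_ne_zero_of_le (Nat.le_succ k) h0
    rw [h.dir_succ, ih h1, cgDual_zero_succ, map_add, map_smul, smul_add, smul_smul _ (cgWeight W r (k + 1)), hw _ h0, one_smul,
      smul_smul, div_mul_cancel₀ _ (by simpa using h1), add_comm]

theorem error_succ' (k : ℕ) : e (k + 1) =
    e k - adjoint W ((α k * ‖adjoint W (r k)‖ ^ 2) • cgDual W r 0 k) := by
  rw [h.error_succ, h.dir_eq, smul_smul, map_smul]

theorem norm_adjoint_cgDual_sq (k : ℕ) :
    ‖adjoint W (cgDual W r 0 k)‖ ^ 2 = cgMass W r k := by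
  have hw : ∀ k, cgWeight W r k ^ 2 * ‖adjoint W (r k)‖ ^ 2 = cgWeight W r k := by
    intro k
    rw [cgWeight]
    by_cases h0 : ‖adjoint W (r k)‖ ^ 2 = 0
    · simp [h0]
    · field_simp
  induction k with
  | zero =>
    simp only [cgDual, cgMass, zero_add, Finset.sum_range_one, max_self, map_smul, norm_smul,
      mul_pow, Real.norm_eq_abs, sq_abs, hw]
  | succ k ih =>
    have h1 : ⟪adjoint W (cgDual W r 0 k), adjoint W (r (k + 1))⟫_ℝ = 0 := by
      rw [cgDual, map_sum, sum_inner]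
      refine Finset.sum_eq_zero fun j hj => ?_
      rw [map_smul, real_inner_smul_left, Nat.zero_max, real_inner_comm,
        h.inner_grad_grad (Finset.mem_range.1 hj), mul_zero]
    rw [cgDual_zero_succ, map_add, map_smul,
      norm_add_sq_real, real_inner_smul_right, h1, norm_smul, mul_pow, Real.norm_eq_abs, sq_abs,
      hw, ih, cgMass, cgMass, Finset.sum_range_succ _ (k + 1)]
    ring

theorem step_eq (k : ℕ) :
    α k * ‖adjoint W (r k)‖ ^ 2 = ‖r k‖ ^ 2 - ‖r (k + 1)‖ ^ 2 := by
  rw [h.residual_succ, norm_sub_smul_sq, ← ContinuousLinearMap.adjoint_inner_left,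
    h.inner_grad_dir, sq (α k), mul_assoc (α k) (α k), h.alpha_mul]
  ring

theorem step_nonneg (k : ℕ) : 0 ≤ α k * ‖adjoint W (r k)‖ ^ 2 := by
  rw [h.alpha]
  positivity

theorem norm_residual_antitone : Antitone fun k => ‖r k‖ := antitone_nat_of_succ_le fun k => by
  refine le_of_sq_le_sq ?_ (norm_nonneg _)
  linarith [h.step_eq k, h.step_nonneg k]

/-- The counterpart of `steepestDescent_one_le`, with effective step size α_k ‖W* r_k‖² times the
mass: ‖d_k‖² is ‖W* r_k‖⁴ times the mass, and ‖W d_k‖ ≤ ‖W‖ ‖d_k‖. -/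
theorem one_le_step_mul_mass {k : ℕ} (hk : adjoint W (r k) ≠ 0) :
    1 ≤ ‖W‖ ^ 2 * (α k * ‖adjoint W (r k)‖ ^ 2 * cgMass W r k) := by
  have h1 := norm_apply_sq_le W (d k)
  have h2 := h.alpha_mul k
  have h3 : ‖d k‖ ^ 2 = (‖adjoint W (r k)‖ ^ 2) ^ 2 * cgMass W r k := by
    rw [h.dir_eq, norm_smul, mul_pow, h.norm_adjoint_cgDual_sq, Real.norm_eq_abs, sq_abs]
  have h4 : 0 ≤ α k := by
    rw [h.alpha]
    positivity
  have h5 : 0 < ‖adjoint W (r k)‖ ^ 2 := by positivity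
  rw [h3] at h1
  have h6 := mul_le_mul_of_nonneg_left h1 h4
  rw [h2] at h6
  refine le_of_mul_le_mul_right ?_ h5
  linarith

/-- Termwise, ⟪r_{max(i,j)}, r_{max(i,m)}⟫ ≤ ‖r_{max(i,m)}‖² = ⟪r_i, r_{max(i,m)}⟫, and the weights
are nonnegative. -/
theorem inner_cgDual_le (i k l : ℕ) :
    ⟪cgDual W r i k, cgDual W r i l⟫_ℝ ≤ cgMass W r k * ⟪r i, cgDual W r i l⟫_ℝ := by
  have h1 := inner_sum_smul_le (Finset.range (k + 1)) (Finset.range (l + 1))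
    (v := fun j => r (max i j)) (v' := fun j => r (max i j)) (c := cgWeight W r)
    (c' := cgWeight W r) (m := fun _ => 1) (r := r i)
    (fun j _ => cgWeight_nonneg W r j) (fun j _ => cgWeight_nonneg W r j) (fun j _ m _ => by
      rw [h.inner_residual, h.inner_residual, one_mul]
      exact pow_le_pow_left₀ (norm_nonneg _) (h.norm_residual_antitone (by omega)) 2)
  simpa only [cgDual, cgMass, mul_one] using h1

theorem inner_residual_cgDual {i k n : ℕ} (hi : i ≤ n) (hk : k ≤ n) :
    ⟪r n, cgDual W r i k⟫_ℝ = cgMass W r k * ‖r n‖ ^ 2 := by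
  rw [cgDual, inner_sum, cgMass, Finset.sum_mul]
  refine Finset.sum_congr rfl fun j hj => ?_
  have := Finset.mem_range.1 hj
  rw [real_inner_smul_right, h.inner_residual_of_le (max_le hi (by omega))]

theorem mass_mul_le_inner {i k : ℕ} (hi : i ≤ k) :
    cgMass W r k * ‖r k‖ ^ 2 ≤ ⟪r i, cgDual W r i k⟫_ℝ := by
  rw [cgDual, inner_sum, cgMass, Finset.sum_mul]
  refine Finset.sum_le_sum fun j hj => ?_
  have := Finset.mem_range.1 hj
  rw [real_inner_smul_right, h.inner_residual]
  refine mul_le_mul_of_nonneg_left ?_ (cgWeight_nonneg W r j)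
  exact pow_le_pow_left₀ (norm_nonneg _) (h.norm_residual_antitone (by omega)) 2

/-- r_n has the same inner product ‖r_n‖² with r_i and with every residual before it. -/
theorem inner_residual_cgHistory {i n : ℕ} (hi : i ≤ n) : ⟪r n, cgHistory W r i⟫_ℝ = 0 := by
  rw [cgHistory, inner_sum]
  refine Finset.sum_eq_zero fun j hj => ?_
  have := Finset.mem_range.1 hj
  rw [real_inner_smul_right, inner_sub_right, h.inner_residual_of_le hi,
    h.inner_residual_of_le (by omega), sub_self, mul_zero]

theorem error_eq {i n : ℕ} (hin : i ≤ n) : e n = e i - adjoint W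
    (∑ k ∈ Finset.Ico i n, (α k * ‖adjoint W (r k)‖ ^ 2) • cgDual W r 0 k) := by
  induction n, hin using Nat.le_induction with
  | base => simp
  | succ n hn ih =>
    rw [h.error_succ', ih, Finset.sum_Ico_succ_top hn, map_add]
    abel

theorem sum_step_eq {i n : ℕ} (hin : i ≤ n) :
    ∑ k ∈ Finset.Ico i n, α k * ‖adjoint W (r k)‖ ^ 2 = ‖r i‖ ^ 2 - ‖r n‖ ^ 2 := by
  induction n, hin using Nat.le_induction with
  | base => simp
  | succ n hn ih =>
    rw [Finset.sum_Ico_succ_top hn, ih, h.step_eq]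
    ring

/-- The error after step `n` in terms of the error after an earlier step `i`. -/
theorem norm_error_sq_le {δ : ℝ} (hη : ‖η‖ ≤ δ) {i n : ℕ} (hin : i ≤ n) :
    ‖e n‖ ^ 2 ≤ ‖e i‖ ^ 2 +
      (∑ k ∈ Finset.Ico i n, α k * ‖adjoint W (r k)‖ ^ 2 * cgMass W r k) * (δ ^ 2 - ‖r n‖ ^ 2) +
      2 * δ * ‖r i‖ ^ 2 * ‖cgHistory W r i‖ := by
  have hδ : 0 ≤ δ := (norm_nonneg _).trans hη
  set a : ℕ → ℝ := fun k => α k * ‖adjoint W (r k)‖ ^ 2 with ha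
  have ha0 : ∀ k, 0 ≤ a k := h.step_nonneg
  set Θ := ∑ k ∈ Finset.Ico i n, a k * cgMass W r k with hΘ
  have hΘ0 : 0 ≤ Θ := Finset.sum_nonneg fun k _ => mul_nonneg (ha0 k) (cgMass_nonneg W r k)
  set y := ∑ k ∈ Finset.Ico i n, a k • cgDual W r i k with hy
  set u := cgHistory W r i with hu
  set A := ∑ k ∈ Finset.Ico i n, a k with hA
  have hA1 : A = ‖r i‖ ^ 2 - ‖r n‖ ^ 2 := h.sum_step_eq hin
  have hA0 : 0 ≤ A := Finset.sum_nonneg fun k _ => ha0 k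
  have hsum : ∑ k ∈ Finset.Ico i n, a k • cgDual W r 0 k = y + A • u := by
    rw [hy, hA, Finset.sum_smul, ← Finset.sum_add_distrib]
    refine Finset.sum_congr rfl fun k hk => ?_
    rw [cgDual_add_cgHistory W r (Finset.mem_Ico.1 hk).1, smul_add]
  have herr := norm_sub_adjoint_sq (h.residual i) (h.residual n) (h.error_eq hin)
  rw [hsum, inner_add_right, inner_add_right, inner_add_right, real_inner_smul_right,
    real_inner_smul_right, real_inner_smul_right, hu, h.inner_residual_cgHistory le_rfl,
    h.inner_residual_cgHistory hin, ← hu] at herr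
  have hrn : ⟪r n, y⟫_ℝ = Θ * ‖r n‖ ^ 2 := by
    rw [hy, inner_sum, hΘ, Finset.sum_mul]
    refine Finset.sum_congr rfl fun k hk => ?_
    rw [real_inner_smul_right, h.inner_residual_cgDual hin (Finset.mem_Ico.1 hk).2.le]
    ring
  have hyy : ‖y‖ ^ 2 ≤ Θ * ⟪r i, y⟫_ℝ := by
    rw [← real_inner_self_eq_norm_sq]
    exact inner_sum_smul_le _ _ (fun k _ => ha0 k) (fun k _ => ha0 k)
      fun k _ l _ => h.inner_cgDual_le i k l
  have hM : 0 ≤ ⟪r i, y⟫_ℝ := by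
    rw [hy, inner_sum]
    refine Finset.sum_nonneg fun k hk => ?_
    rw [real_inner_smul_right]
    refine mul_nonneg (ha0 k) (le_trans ?_ (h.mass_mul_le_inner (Finset.mem_Ico.1 hk).1))
    exact mul_nonneg (cgMass_nonneg W r k) (sq_nonneg _)
  -- Arithmetic-geometric mean on `hyy`: the term ⟪r i, y⟫ is cancelled by its negative in `herr`,
  -- and Θ δ² is left to compete with -Θ ‖r n‖².
  have hηy : 2 * (δ * ‖y‖) ≤ ⟪r i, y⟫_ℝ + Θ * δ ^ 2 := by
    refine le_of_sq_le_sq ?_ (by positivity)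
    have := mul_le_mul_of_nonneg_left hyy (sq_nonneg δ)
    nlinarith [sq_nonneg (⟪r i, y⟫_ℝ - Θ * δ ^ 2)]
  have h1 : ⟪η, y⟫_ℝ ≤ δ * ‖y‖ :=
    (real_inner_le_norm _ _).trans (mul_le_mul_of_nonneg_right hη (norm_nonneg _))
  have h2 : ⟪η, u⟫_ℝ ≤ δ * ‖u‖ :=
    (real_inner_le_norm _ _).trans (mul_le_mul_of_nonneg_right hη (norm_nonneg _))
  have h3 : A * ⟪η, u⟫_ℝ ≤ ‖r i‖ ^ 2 * (δ * ‖u‖) :=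
    (mul_le_mul_of_nonneg_left h2 hA0).trans (mul_le_mul_of_nonneg_right
      (by linarith [sq_nonneg ‖r n‖]) (by positivity))
  rw [hrn] at herr
  linarith

/-- The length of a step that starts before the discrepancy principle is met. -/
theorem norm_step_le {δ τ : ℝ} (hτ : 1 < τ) (hδ : 0 < δ) (hη : ‖η‖ ≤ δ) {j k : ℕ} (hjk : j ≤ k)
    (hres : τ * δ < ‖r k‖) : ‖e (k + 1) - e k‖ ≤
      τ / (τ - 1) * (‖e j‖ + δ * ‖cgHistory W r j‖ * ‖adjoint W (r j)‖) := by
  have hτ' : 0 < τ - 1 := by linarith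
  have hτδ : 0 < τ * δ := by positivity
  have hstep : ‖e (k + 1) - e k‖ = α k * ‖adjoint W (r k)‖ ^ 2 * √(cgMass W r k) := by
    rw [h.error_succ', map_smul, sub_sub_cancel_left, norm_neg, norm_smul,
      Real.norm_of_nonneg (h.step_nonneg k), ← h.norm_adjoint_cgDual_sq,
      Real.sqrt_sq (norm_nonneg _)]
  have hsj : adjoint W (r j) ≠ 0 := adjoint_residual_ne_zero hτ hδ hη (h.residual j)
    (hres.trans_le (h.norm_residual_antitone hjk))
  have hσ0 := cgMass_nonneg W r k
  have hsq := Real.sq_sqrt hσ0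
  have hnorm : ‖adjoint W (cgDual W r 0 k)‖ = √(cgMass W r k) := by
    rw [← h.norm_adjoint_cgDual_sq, Real.sqrt_sq (norm_nonneg _)]
  -- Bounds the reciprocal of √(cgMass W r k) by a quantity at j, so that the history term does not
  -- depend on k.
  have hone : 1 ≤ √(cgMass W r k) * ‖adjoint W (r j)‖ := by
    refine le_of_sq_le_sq ?_ (by positivity)
    rw [mul_pow, hsq, one_pow]
    have h1 : cgWeight W r j ≤ cgMass W r k := Finset.single_le_sum
      (fun i _ => cgWeight_nonneg W r i) (Finset.mem_range.2 (by omega))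
    refine le_trans (le_of_eq ?_) (mul_le_mul_of_nonneg_right h1 (sq_nonneg _))
    exact (inv_mul_cancel₀ (by simpa using hsj)).symm
  rw [hstep]
  have hx : 0 < √(cgMass W r k) := by
    by_contra hx
    have : √(cgMass W r k) * ‖adjoint W (r j)‖ ≤ 0 :=
      mul_nonpos_of_nonpos_of_nonneg (not_lt.1 hx) (norm_nonneg _)
    linarith
  set x := √(cgMass W r k)
  set u := cgHistory W r j
  set q := cgDual W r j k with hq
  set N := ⟪r j, q⟫_ℝ with hN
  have hN1 : x ^ 2 * ‖r k‖ ^ 2 ≤ N := hsq ▸ h.mass_mul_le_inner hjk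
  have hN0 : 0 ≤ N := le_trans (by positivity) hN1
  have hqq : ‖q‖ ^ 2 ≤ x ^ 2 * N := by
    rw [← real_inner_self_eq_norm_sq, hsq]
    exact h.inner_cgDual_le j k k
  have h1 : N - ⟪η, q⟫_ℝ - ⟪η, u⟫_ℝ ≤ ‖e j‖ * x := by
    have h2 := real_inner_le_norm (e j) (adjoint W (cgDual W r 0 k))
    rw [hnorm, ContinuousLinearMap.adjoint_inner_right, eq_sub_of_add_eq (h.residual j).symm,
      cgDual_add_cgHistory W r hjk, inner_sub_left, inner_add_right, inner_add_right,
      h.inner_residual_cgHistory le_rfl] at h2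
    linarith
  have h2 : ⟪η, q⟫_ℝ ≤ δ * ‖q‖ :=
    (real_inner_le_norm _ _).trans (mul_le_mul_of_nonneg_right hη (norm_nonneg _))
  have h3 : ⟪η, u⟫_ℝ ≤ δ * ‖u‖ :=
    (real_inner_le_norm _ _).trans (mul_le_mul_of_nonneg_right hη (norm_nonneg _))
  -- The noise pairing with q is absorbed into N, which keeps the fraction 1 - 1/τ.
  have h4 : τ * δ * ‖q‖ ≤ N := by
    refine le_of_sq_le_sq ?_ hN0
    rw [mul_pow]
    calc (τ * δ) ^ 2 * ‖q‖ ^ 2 ≤ ‖r k‖ ^ 2 * (x ^ 2 * N) := by gcongr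
      _ = x ^ 2 * ‖r k‖ ^ 2 * N := by ring
      _ ≤ N * N := by gcongr
      _ = N ^ 2 := (sq N).symm
  have h5 : (τ - 1) * N ≤ τ * (x * ‖e j‖ + δ * ‖u‖) := by
    have := mul_le_mul_of_nonneg_left (show N ≤ ‖e j‖ * x + δ * ‖q‖ + δ * ‖u‖ by linarith)
      (show 0 ≤ τ by linarith)
    linarith
  have h6 : α k * ‖adjoint W (r k)‖ ^ 2 ≤ ‖r k‖ ^ 2 := by
    rw [h.step_eq]
    linarith [sq_nonneg ‖r (k + 1)‖]
  have h7 : δ * ‖u‖ * 1 ≤ δ * ‖u‖ * (x * ‖adjoint W (r j)‖) := by gcongr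
  rw [div_mul_eq_mul_div, le_div_iff₀ hτ']
  refine le_of_mul_le_mul_left ?_ hx
  calc x * (α k * ‖adjoint W (r k)‖ ^ 2 * x * (τ - 1))
      = (τ - 1) * (x ^ 2 * (α k * ‖adjoint W (r k)‖ ^ 2)) := by ring
    _ ≤ (τ - 1) * (x ^ 2 * ‖r k‖ ^ 2) := by gcongr
    _ ≤ (τ - 1) * N := by gcongr
    _ ≤ τ * (x * ‖e j‖ + δ * ‖u‖) := h5
    _ ≤ τ * (x * ‖e j‖ + δ * ‖u‖ * (x * ‖adjoint W (r j)‖)) :=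
        mul_le_mul_of_nonneg_left (by linarith) (by linarith)
    _ = _ := by ring

end IsCGSequence

theorem isCGSequence_cgState (W : X →L[ℝ] Y) (f : X) (g : Y) :
    IsCGSequence W (g - W f) (fun k => f - (cgState W g k).f) (fun k => (cgState W g k).r)
      (fun k => (cgState W g k).d)
      (fun k => ‖adjoint W (cgState W g k).r‖ ^ 2 / ‖W (cgState W g k).d‖ ^ 2) where
  residual k := by
    rw [apply_error_add_noise]
    induction k with
    | zero => rfl
    | succ k ih =>
      simp only [cgState, CGState.next, map_add, map_smul, ih]
      abel
  alpha _ := rfl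
  error_succ k := by
    simp only [cgState, CGState.next]
    abel
  dir_zero := rfl
  dir_succ _ := rfl

/-- The recursion divides by ‖W d_k‖² and ‖W* r_k‖²; at exact data both are nonzero until the
iterate equals f. -/
theorem tendsto_cgState {W : X →L[ℝ] Y} (hW : Function.Injective W) (f : X) (j : ℕ)
    (hj : ∀ l < j, (cgState W (W f) l).f ≠ f) :
    Tendsto (fun g => (cgState W g j).f) (𝓝 (W f)) (𝓝 (cgState W (W f) j).f) ∧
    Tendsto (fun g => (cgState W g j).r) (𝓝 (W f)) (𝓝 (cgState W (W f) j).r) ∧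
    Tendsto (fun g => (cgState W g j).d) (𝓝 (W f)) (𝓝 (cgState W (W f) j).d) := by
  induction j with
  | zero =>
    have h1 : Tendsto (fun g : Y => g - W 0) (𝓝 (W f)) (𝓝 (W f - W 0)) :=
      tendsto_id.sub_const _
    exact ⟨tendsto_const_nhds, h1, ((adjoint W).continuous.tendsto _).comp h1⟩
  | succ k ih =>
    obtain ⟨hf, hr, hd⟩ := ih fun l hl => hj l (by omega)
    have hcg := isCGSequence_cgState W f (W f)
    have hs0 : ‖adjoint W (cgState W (W f) k).r‖ ^ 2 ≠ 0 := by
      have h1 := hcg.residual k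
      rw [sub_self, add_zero] at h1
      refine pow_ne_zero 2 (norm_ne_zero_iff.2 ?_)
      rw [h1, Ne, adjoint_apply_eq_zero_iff hW, sub_eq_zero]
      exact (hj k (Nat.lt_succ_self k)).symm
    have hd0 : ‖W (cgState W (W f) k).d‖ ^ 2 ≠ 0 := fun h0 => hs0 <| by
      rw [← hcg.alpha_mul k, h0, mul_zero]
    have hs := ((adjoint W).continuous.tendsto _).comp hr
    have hWd := (W.continuous.tendsto _).comp hd
    have hα := (hs.norm.pow 2).div (hWd.norm.pow 2) hd0
    have hr' := hr.sub (hα.smul hWd)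
    have hs' := ((adjoint W).continuous.tendsto _).comp hr'
    exact ⟨hf.add (hα.smul hd), hr',
      hs'.add (((hs'.norm.pow 2).div (hs.norm.pow 2) hs0).smul hd)⟩

theorem tendsto_cgHistory {W : X →L[ℝ] Y} (hW : Function.Injective W) (f : X) (j : ℕ)
    (hj : ∀ l < j, (cgState W (W f) l).f ≠ f) :
    Tendsto (fun g => cgHistory W (fun k => (cgState W g k).r) j) (𝓝 (W f))
      (𝓝 (cgHistory W (fun k => (cgState W (W f) k).r) j)) := by
  refine tendsto_finsetSum _ fun l hl => ?_
  have hlj := Finset.mem_range.1 hl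
  have h1 := (tendsto_cgState hW f l fun m hm => hj m (hm.trans hlj)).2.1
  have h2 := (tendsto_cgState hW f j hj).2.1
  refine Tendsto.smul ?_ (h1.sub h2)
  have hs := ((adjoint W).continuous.tendsto _).comp h1
  refine (hs.norm.pow 2).inv₀ (pow_ne_zero 2 (norm_ne_zero_iff.2 ?_))
  have h3 := (isCGSequence_cgState W f (W f)).residual l
  rw [sub_self, add_zero] at h3
  rw [h3, Ne, adjoint_apply_eq_zero_iff hW, sub_eq_zero]
  exact (hj l hlj).symm

/-- As for steepest descent, with α_k ‖W* r_k‖² times the mass as step size; pairing a later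
residual r_k with the i-th dual sum gives exactly the mass times ‖r_k‖². -/
theorem IsCGSequence.tendsto_error {W : X →L[ℝ] Y} (hW : Function.Injective W) {e : ℕ → X}
    {r : ℕ → Y} {d : ℕ → X} {α : ℕ → ℝ} (h : IsCGSequence W 0 e r d α) :
    Tendsto e atTop (𝓝 0) := by
  have hr : ∀ k, r k = W (e k) := fun k => by rw [h.residual, add_zero]
  have hdiff : ∀ k, ‖e k‖ ^ 2 - ‖e (k + 1)‖ ^ 2 =
      α k * ‖adjoint W (r k)‖ ^ 2 * cgMass W r k * (‖r k‖ ^ 2 + ‖r (k + 1)‖ ^ 2) := by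
    intro k
    rw [norm_sub_adjoint_sq (h.residual k) (h.residual (k + 1)) (h.error_succ' k),
      real_inner_smul_right, real_inner_smul_right, inner_zero_left,
      h.inner_residual_cgDual (Nat.zero_le k) le_rfl,
      h.inner_residual_cgDual (Nat.zero_le _) (Nat.le_succ k)]
    ring
  refine tendsto_zero_of_energy hW (c := (‖W‖ ^ 2 + 1)⁻¹) (C := 1) (by positivity)
    (fun k => ?_) fun i k hik => ?_
  · have h0 := mul_nonneg (h.step_nonneg k) (cgMass_nonneg W r k)
    rw [hdiff, ← hr, inv_mul_le_iff₀ (by positivity)]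
    by_cases hs : adjoint W (r k) = 0
    · rw [hr, adjoint_apply_eq_zero_iff hW] at hs
      rw [hr k, hs, map_zero, norm_zero, zero_pow two_ne_zero]
      simp
    · have h1 := h.one_le_step_mul_mass hs
      set m := α k * ‖adjoint W (r k)‖ ^ 2 * cgMass W r k
      have h2 : 1 * ‖r k‖ ^ 2 ≤ ((‖W‖ ^ 2 + 1) * m) * ‖r k‖ ^ 2 := by
        gcongr
        linarith
      have h3 : 0 ≤ ((‖W‖ ^ 2 + 1) * m) * ‖r (k + 1)‖ ^ 2 := by positivity
      linarith
  · rw [hdiff, h.error_succ', sub_sub_cancel, ContinuousLinearMap.adjoint_inner_right, ← hr,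
      real_inner_smul_right, h.inner_residual_cgDual (Nat.zero_le k) hik.le, one_mul,
      ← mul_assoc]
    have h0 := mul_nonneg (h.step_nonneg i) (cgMass_nonneg W r i)
    rw [abs_of_nonneg (mul_nonneg h0 (sq_nonneg _))]
    refine mul_le_mul_of_nonneg_left ?_ h0
    have := pow_le_pow_left₀ (norm_nonneg _) (h.norm_residual_antitone hik.le) 2
    linarith [sq_nonneg ‖r (i + 1)‖]

theorem isRegularIteration_cg {W : X →L[ℝ] Y} (hW : Function.Injective W) (f : X) :
    IsRegularIteration W (fun g k => (cgState W g k).f) f := by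
  have hres : ∀ g k, (cgState W g k).r = g - W (cgState W g k).f := fun g k =>
    ((isCGSequence_cgState W f g).residual k).trans (apply_error_add_noise _ _ _ _)
  refine ⟨?_, fun j hj => (tendsto_cgState hW f j hj).1, ?_, ?_⟩
  · have h := isCGSequence_cgState W f (W f)
    rw [sub_self] at h
    simpa using (h.tendsto_error hW).const_sub f
  · intro τ δ g hτ hδ hg
    by_contra! hcon
    have h := isCGSequence_cgState W f g
    have hr : ∀ k, τ * δ < ‖(cgState W g k).r‖ := fun k => by
      rw [hres, norm_sub_rev]
      exact hcon k
    obtain ⟨n, hn⟩ := exists_nat_gt (‖W‖ ^ 2 * ‖f‖ ^ 2 / ((τ ^ 2 - 1) * δ ^ 2))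
    have hτδ : 0 < (τ ^ 2 - 1) * δ ^ 2 := mul_pos (by nlinarith) (by positivity)
    rw [div_lt_iff₀ hτδ] at hn
    -- Started at 0 there is no history term, so the weighted sum Θ is bounded; but it grows at
    -- least linearly in n.
    have h1 := h.norm_error_sq_le hg (Nat.zero_le n)
    have h2 : (n : ℝ) ≤ ‖W‖ ^ 2 * ∑ k ∈ Finset.Ico 0 n,
        ‖adjoint W (cgState W g k).r‖ ^ 2 / ‖W (cgState W g k).d‖ ^ 2 *
          ‖adjoint W (cgState W g k).r‖ ^ 2 * cgMass W (fun k => (cgState W g k).r) k := by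
      rw [Finset.mul_sum]
      have := Finset.card_nsmul_le_sum (Finset.Ico 0 n) _ 1 fun k _ =>
        h.one_le_step_mul_mass (adjoint_residual_ne_zero hτ hδ hg (h.residual k) (hr k))
      simpa using this
    set Θ := ∑ k ∈ Finset.Ico 0 n,
        ‖adjoint W (cgState W g k).r‖ ^ 2 / ‖W (cgState W g k).d‖ ^ 2 *
          ‖adjoint W (cgState W g k).r‖ ^ 2 * cgMass W (fun k => (cgState W g k).r) k
    have hΘ : 0 ≤ Θ := Finset.sum_nonneg fun k _ =>
      mul_nonneg (h.step_nonneg k) (cgMass_nonneg W _ k)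
    have h3 : (τ * δ) ^ 2 ≤ ‖(cgState W g n).r‖ ^ 2 :=
      pow_le_pow_left₀ (by positivity) (hr n).le 2
    have h4 : ‖cgHistory W (fun k => (cgState W g k).r) 0‖ = 0 := by simp [cgHistory]
    have h5 : (cgState W g 0).f = 0 := rfl
    simp only [h4, h5, sub_zero, mul_zero, add_zero] at h1
    have h6 : Θ * ((τ ^ 2 - 1) * δ ^ 2) ≤ ‖f‖ ^ 2 := by
      have := mul_le_mul_of_nonneg_left h3 hΘ
      linarith [sq_nonneg ‖f - (cgState W g n).f‖]
    have h7 := mul_le_mul_of_nonneg_left h6 (sq_nonneg ‖W‖)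
    have h8 := mul_le_mul_of_nonneg_right h2 hτδ.le
    linarith
  · intro τ hτ
    have hτ' : 0 < τ - 1 := by linarith
    -- The square root comes from the history term in the error up to n - 1, the other summand from
    -- the length of the last step. For fixed j both carry a factor that vanishes with δ.
    refine ⟨1 + τ / (τ - 1), by positivity, fun j hj => ⟨fun δ g =>
      √(2 * δ * ‖(cgState W g j).r‖ ^ 2 * ‖cgHistory W (fun k => (cgState W g k).r) j‖) +
        τ / (τ - 1) * (δ * ‖cgHistory W (fun k => (cgState W g k).r) j‖ *
          ‖adjoint W (cgState W g j).r‖), ?_, fun δ g n hδ hg hjn hn => ?_⟩⟩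
    · have hδ : Tendsto (fun z : ℝ × Y => z.1) (𝓝 0 ×ˢ 𝓝 (W f)) (𝓝 0) := tendsto_fst
      have hu := ((tendsto_cgHistory hW f j hj).comp
        (tendsto_snd (f := 𝓝 (0 : ℝ)) (g := 𝓝 (W f)))).norm
      have hr := (tendsto_cgState hW f j hj).2.1.comp
        (tendsto_snd (f := 𝓝 (0 : ℝ)) (g := 𝓝 (W f)))
      have hs := (((adjoint W).continuous.tendsto _).comp hr).norm
      have h1 := ((((hδ.const_mul 2).mul (hr.norm.pow 2)).mul hu).sqrt).add
        (((hδ.mul hu).mul hs).const_mul (τ / (τ - 1)))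
      simp only [mul_zero, zero_mul, Real.sqrt_zero, add_zero] at h1
      exact h1
    · have h := isCGSequence_cgState W f g
      have hr : ∀ k < n, τ * δ < ‖(cgState W g k).r‖ := fun k hk => by
        rw [hres, norm_sub_rev]
        exact hn k hk
      rw [norm_sub_rev, norm_sub_rev _ f]
      rcases hjn.eq_or_lt with rfl | hlt
      · refine le_trans ?_ (le_add_of_nonneg_right (by positivity))
        rw [add_mul, one_mul]
        exact le_add_of_nonneg_right (by positivity)
      · obtain ⟨l, rfl⟩ := Nat.exists_eq_add_of_lt hlt
        have hjl : j ≤ j + l := Nat.le_add_right j l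
        have h1 := h.norm_step_le hτ hδ hg hjl (hr (j + l) (by omega))
        have h2 := h.norm_error_sq_le hg hjl
        have h3 : (τ * δ) ^ 2 ≤ ‖(cgState W g (j + l)).r‖ ^ 2 :=
          pow_le_pow_left₀ (by positivity) (hr _ (by omega)).le 2
        have h4 : δ ^ 2 - ‖(cgState W g (j + l)).r‖ ^ 2 ≤ 0 := by
          have : 1 * δ ^ 2 ≤ τ ^ 2 * δ ^ 2 :=
            mul_le_mul_of_nonneg_right (by nlinarith) (sq_nonneg δ)
          rw [mul_pow] at h3
          linarith
        have h5 := mul_nonpos_of_nonneg_of_nonpos (Finset.sum_nonneg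
          fun k (_ : k ∈ Finset.Ico j (j + l)) =>
            mul_nonneg (h.step_nonneg k) (cgMass_nonneg W (fun k => (cgState W g k).r) k)) h4
        set u := cgHistory W (fun k => (cgState W g k).r) j
        have h6 : ‖f - (cgState W g (j + l)).f‖ ≤ ‖f - (cgState W g j).f‖ +
            √(2 * δ * ‖(cgState W g j).r‖ ^ 2 * ‖u‖) := by
          refine le_of_sq_le_sq ?_ (by positivity)
          have h7 := Real.sq_sqrt
            (show 0 ≤ 2 * δ * ‖(cgState W g j).r‖ ^ 2 * ‖u‖ by positivity)
          have h8 := mul_nonneg (norm_nonneg (f - (cgState W g j).f))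
            (Real.sqrt_nonneg (2 * δ * ‖(cgState W g j).r‖ ^ 2 * ‖u‖))
          rw [add_sq, h7]
          linarith
        have h9 := norm_le_norm_add_norm_sub' (f - (cgState W g (j + l + 1)).f)
          (f - (cgState W g (j + l)).f)
        linarith

/-- Every admissible method is a regular iteration. -/
theorem Method.isRegularIteration {W : X →L[ℝ] Y} (hW : Function.Injective W) {M : Method}
    (hM : M.Admissible W) (f : X) : IsRegularIteration W (fun g => M.iterate W g) f := by
  cases M with
  | landweber γ =>
    refine isRegularIteration_landweber hW hM.1 ?_ f
    -- Admissibility is stated with ‖W* W‖, which equals ‖W‖².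
    rw [sq, ← ContinuousLinearMap.norm_adjoint_comp_self]
    exact hM.2
  | steepestDescent => exact isRegularIteration_steepestDescent hW f
  | cg => exact isRegularIteration_cg hW f

end ConjugateGradients

end PAT

/-! ### Application to the photoacoustic forward operator. -/

theorem mainTheorem5 {d : ℕ} (P : PAT.Setting d) (i : Fin 2)
    (hW : Function.Injective (P.forward i))
    (M : PAT.Method) (hM : M.Admissible (P.forward i)) (f : P.X i) :
    -- exact data
    Tendsto (fun k => ‖M.iterate (P.forward i) (P.forward i f) k - f‖) atTop (𝓝 0) ∧
    -- noisy data with the discrepancy principle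
    ∀ τ : ℝ, 1 < τ → ∀ (δ : ℕ → ℝ) (g : ℕ → P.Y i), (∀ m, 0 < δ m) → Tendsto δ atTop (𝓝 0) →
      (∀ m, ‖g m - P.forward i f‖ ≤ δ m) →
      (∀ m, IsLeast (PAT.discrepancySet (P.forward i) M τ (δ m) (g m))
        (PAT.stoppingIndex (P.forward i) M τ (δ m) (g m))) ∧
      Tendsto (fun m => ‖M.iterate (P.forward i) (g m)
        (PAT.stoppingIndex (P.forward i) M τ (δ m) (g m)) - f‖) atTop (𝓝 0) := by
  have h := PAT.Method.isRegularIteration hW hM f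
  refine ⟨tendsto_iff_norm_sub_tendsto_zero.1 h.exact_data, fun τ hτ δ g hδ hδ0 hg => ?_⟩
  exact h.discrepancy hW hτ hδ hδ0 hg
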